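/- Let $R$ be a commutative Noetherian ring with non-zero identity, let $I$ be a proper ideal of $R$, and let $M,N$ be finitely generated $R$-modules. For $R$-modules $X,Y$ and an integer $i\ge 0$, let $$H^i_I(X,Y)=\varinjlim_q \operatorname{Ext}^i_R(X/I^qX,\,Y)$$ be the generalized local cohomology module, where the direct system is induced by the natural maps $X/I^{q+1}X\to X/I^qX$, and let $H^i_I(Y)=H^i_I(R,Y)$ be the ordinary local cohomology module. Put $$\operatorname{cd}_I(X,Y)=\sup\{i\ge 0\mid H^i_I(X,Y)\neq 0\},\qquad \operatorname{cd}_I Y=\sup\{i\ge 0\mid H^i_I(Y)\neq 0\},\qquad e_R(X,Y)=\sup\{i\ge 0\mid \operatorname{Ext}^i_R(X,Y)\neq 0\},$$ with values in $\{-\infty\}\cup\mathbb{N}\cup\{\infty\}$, where $\sup\emptyset=-\infty$ and $-\infty+a=a+(-\infty)=-\infty$ for every $a$. Then: 1. $\operatorname{cd}_I(M,N)\le \operatorname{cd}_I(M\otimes_R N)+e_R(M,N)$, and $\operatorname{cd}_I(M\otimes_R N)<\infty$. 2. Suppose that $e_R(M,N)<\infty$ and that $e_R(M,N)\ne-\infty$,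 so that $e=e_R(M,N)$ is a non-negative integer. If $c=\operatorname{cd}_I(M\otimes_R N)\neq-\infty$, there is an isomorphism of $R$-modules $$H^{c+e}_I(M,N)\cong H^{c}_I\bigl(\operatorname{Ext}^{e}_R(M,N)\bigr).$$ Moreover (also when $\operatorname{cd}_I(M\otimes_R N)=-\infty$), the equality $\operatorname{cd}_I(M,N)=\operatorname{cd}_I(M\otimes_R N)+e_R(M,N)$ holds if and only if $\operatorname{cd}_I\operatorname{Ext}^{e}_R(M,N)=\operatorname{cd}_I(M\otimes_R N)$. -/

import Mathlib

open CategoryTheory Abelian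
open scoped TensorProduct

universe u

noncomputable section

namespace GenLocalCohomology

variable {R : Type u} [CommRing R]

/-- The module `M / I^q M`, as an object of the category of `R`-modules. -/
abbrev powQuot (I : Ideal R) (M : Type u) [AddCommGroup M] [Module R M] (q : ℕ) :
    ModuleCat.{u} R :=
  ModuleCat.of R (M ⧸ (I ^ q • ⊤ : Submodule R M))

/-- The natural surjection `M / I^q M ⟶ M / I^p M` for `p ≤ q`. -/
def powQuotMap (I : Ideal R) (M : Type u) [AddCommGroup M] [Module R M] {p q : ℕ} (h : p ≤ q) :
    powQuot I M q ⟶ powQuot I M p :=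
  ModuleCat.ofHom (Submodule.factor (Submodule.smul_mono_left (Ideal.pow_le_pow_right h)))

/-- The map `Ext^i(M / I^p M, N) → Ext^i(M / I^q M, N)` (for `p ≤ q`) induced by the natural
surjection `M / I^q M ⟶ M / I^p M`. -/
def extTransition (I : Ideal R) (M N : Type u) [AddCommGroup M] [Module R M]
    [AddCommGroup N] [Module R N] (i p q : ℕ) (h : p ≤ q) :
    Ext (powQuot I M p) (ModuleCat.of R N) i →ₗ[R] Ext (powQuot I M q) (ModuleCat.of R N) i :=
  (Ext.mk₀ (powQuotMap I M h)).precompOfLinear R (ModuleCat.of R N) (zero_add i)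

lemma powQuotMap_self (I : Ideal R) (M : Type u) [AddCommGroup M] [Module R M] (p : ℕ) :
    powQuotMap I M (le_refl p) = 𝟙 _ := by
  ext x
  rfl

lemma powQuotMap_comp (I : Ideal R) (M : Type u) [AddCommGroup M] [Module R M] {p q r : ℕ}
    (h : p ≤ q) (h' : q ≤ r) :
    powQuotMap I M h' ≫ powQuotMap I M h = powQuotMap I M (h.trans h') := by
  ext x
  rfl

/-- The modules `Ext^i(M / I^q M, N)`, `q : ℕ`, form a direct system. -/
instance (I : Ideal R) (M N : Type u) [AddCommGroup M] [Module R M]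
    [AddCommGroup N] [Module R N] (i : ℕ) :
    DirectedSystem (fun q : ℕ => Ext (powQuot I M q) (ModuleCat.of R N) i)
      (fun p q h => extTransition I M N i p q h) where
  map_self p x := by simp [extTransition, powQuotMap_self]
  map_map p q r h h' x := by simp [extTransition, ← powQuotMap_comp I M h h']

/-- The generalized local cohomology module `H^i_I(M, N) = colim_q Ext^i(M / I^q M, N)`. -/
abbrev genLocalCohomology (I : Ideal R) (M N : Type u) [AddCommGroup M] [Module R M]
    [AddCommGroup N] [Module R N] (i : ℕ) : Type u :=
  Module.DirectLimit (fun q : ℕ => Ext (powQuot I M q) (ModuleCat.of R N) i)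
    (extTransition I M N i)

/-- The local cohomology module `H^i_I(N) = H^i_I(R, N) = colim_q Ext^i(R / I^q, N)`. -/
abbrev localCohomologyModule (I : Ideal R) (N : Type u) [AddCommGroup N] [Module R N] (i : ℕ) :
    Type u :=
  genLocalCohomology I R N i

/-- The cohomological dimension of the pair `M, N` with respect to `I`: the supremum of all `i`
with `H^i_I(M, N) ≠ 0`. The supremum of the empty set is `-∞ = ⊥`. -/
def cdPair (I : Ideal R) (M N : Type u) [AddCommGroup M] [Module R M]
    [AddCommGroup N] [Module R N] : WithBot ℕ∞ :=
  ⨆ (i : ℕ) (_ : Nontrivial (genLocalCohomology I M N i)), (i : WithBot ℕ∞)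

/-- The cohomological dimension of `N` with respect to `I`: the supremum of all `i`
with `H^i_I(N) ≠ 0`. The supremum of the empty set is `-∞ = ⊥`. -/
def cd (I : Ideal R) (N : Type u) [AddCommGroup N] [Module R N] : WithBot ℕ∞ :=
  ⨆ (i : ℕ) (_ : Nontrivial (localCohomologyModule I N i)), (i : WithBot ℕ∞)

/-- The invariant `e_R(M, N)`: the supremum of all `i` with `Ext^i_R(M, N) ≠ 0`.
The supremum of the empty set is `-∞ = ⊥`. -/
def extSup (R : Type u) [CommRing R] (M N : Type u) [AddCommGroup M] [Module R M]
    [AddCommGroup N] [Module R N] : WithBot ℕ∞ :=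
  ⨆ (i : ℕ) (_ : Nontrivial (Ext (ModuleCat.of R M) (ModuleCat.of R N) i)), (i : WithBot ℕ∞)

end GenLocalCohomology

end

/-! The statement is read off the Grothendieck spectral sequence H^p_I(Ext^q(M,N)) ⇒ H^{p+q}_I(M,N).
Such a sequence exists because H^0_I(M,X) ≅ H^0_I(Hom(M,X)) naturally (`lcZeroEquiv`) and because
Hom(M,E) has no higher local cohomology when E is injective, an effect of the Artin-Rees lemma
(`subsingleton_lc_linearMap`).

Only the support of the E_2 page matters. Rows q > e vanish by definition of e. Columns p > c vanish
for c = cd(M ⊗ N): Ext^q(M,N) is supported in Supp(M ⊗ N) (`support_ext_subset`), and for finitely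
generated modules the vanishing of H^p_I in all degrees p ≥ c passes to modules of smaller support
(`subsingleton_lc_of_support_subset`). Hence H^i_I(M,N) = 0 for i > c + e, and the corner survives:
H^{c+e}_I(M,N) ≅ H^c_I(Ext^e(M,N)). Both sides of the final equivalence then say that this module is
nonzero. Finiteness of cd comes from I having finitely many generators (`subsingleton_lc_span`).

The spectral sequence itself is never built. Its two consequences,
`subsingleton_lc_of_ext_antidiagonal` and `nonempty_lc_equiv_ext`, are proved by dimension shifting
along 0 → N → E → Z → 0 with E injective. -/

noncomputable section

namespace GenLocalCohomology

variable {R : Type u} [CommRing R]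

/-- The linear maps `f` and `g` form a short exact sequence `0 → X → Y → Z → 0`. -/
structure IsSES {X Y Z : Type u} [AddCommGroup X] [Module R X] [AddCommGroup Y] [Module R Y]
    [AddCommGroup Z] [Module R Z] (f : X →ₗ[R] Y) (g : Y →ₗ[R] Z) : Prop where
  inj : Function.Injective f
  exact : Function.Exact f g
  surj : Function.Surjective g

/-! ### Short exact sequences of linear maps. -/

section SES

variable {X Y Z : Type u} [AddCommGroup X] [Module R X] [AddCommGroup Y] [Module R Y]
    [AddCommGroup Z] [Module R Z] {f : X →ₗ[R] Y} {g : Y →ₗ[R] Z}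

/-- The short complex of module objects attached to a short exact sequence of linear maps. -/
abbrev IsSES.complex (h : IsSES f g) : ShortComplex (ModuleCat.{u} R) :=
  ShortComplex.mk (ModuleCat.ofHom f) (ModuleCat.ofHom g) (by
    ext x; exact h.exact.apply_apply_eq_zero x)

lemma IsSES.shortExact (h : IsSES f g) : h.complex.ShortExact where
  exact := (ShortComplex.ShortExact.moduleCat_exact_iff_function_exact _).2 h.exact
  mono_f := (ModuleCat.mono_iff_injective _).2 h.inj
  epi_g := (ModuleCat.epi_iff_surjective _).2 h.surj

lemma isSES_mkQ (S : Submodule R X) : IsSES S.subtype S.mkQ :=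
  ⟨S.injective_subtype, LinearMap.exact_subtype_mkQ S, S.mkQ_surjective⟩

lemma isSES_ker (hg : Function.Surjective g) : IsSES (LinearMap.ker g).subtype g :=
  ⟨Submodule.injective_subtype _, LinearMap.exact_subtype_ker_map g, hg⟩

lemma isSES_mkQ_range (hf : Function.Injective f) : IsSES f (LinearMap.range f).mkQ :=
  ⟨hf, LinearMap.exact_map_mkQ_range f, Submodule.mkQ_surjective _⟩

lemma isSES_rangeRestrict (hf : Function.Injective f) (h : Function.Exact f g) :
    IsSES f g.rangeRestrict :=
  ⟨hf, fun y => by rw [← h y, Subtype.ext_iff]; rfl, g.surjective_rangeRestrict⟩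

lemma isSES_range_subtype (h : Function.Exact f g) (hg : Function.Surjective g) :
    IsSES (LinearMap.range f).subtype g :=
  ⟨Submodule.injective_subtype _, fun y => by rw [h y]; simp, hg⟩

end SES

/-! ### The covariant long exact sequence of Ext. -/

section Ext

variable (A : ModuleCat.{u} R) {X Y Z : Type u} [AddCommGroup X] [Module R X]
    [AddCommGroup Y] [Module R Y] [AddCommGroup Z] [Module R Z]

/-- The map `Ext^i(A, X) → Ext^i(A, Y)` induced by a linear map `X → Y`. -/
abbrev extMap (f : X →ₗ[R] Y) (i : ℕ) :
    Ext A (ModuleCat.of R X) i →ₗ[R] Ext A (ModuleCat.of R Y) i :=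
  (Ext.mk₀ (ModuleCat.ofHom f)).postcompOfLinear R A (add_zero i)

/-- The connecting map `Ext^i(A, Z) → Ext^{i+1}(A, X)` of a short exact sequence. -/
abbrev extδ {f : X →ₗ[R] Y} {g : Y →ₗ[R] Z} (h : IsSES f g) (i : ℕ) :
    Ext A (ModuleCat.of R Z) i →ₗ[R] Ext A (ModuleCat.of R X) (i + 1) :=
  h.shortExact.extClass.postcompOfLinear R A rfl

variable {A} {f : X →ₗ[R] Y} {g : Y →ₗ[R] Z} (h : IsSES f g)

lemma extMap_apply {n : ℕ} (x : Ext A (ModuleCat.of R X) n) :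
    extMap A f n x = x.comp (Ext.mk₀ (ModuleCat.ofHom f)) (add_zero n) := rfl

lemma extδ_apply {n : ℕ} (x : Ext A (ModuleCat.of R Z) n) :
    extδ A h n x = x.comp h.shortExact.extClass rfl := rfl

include h in
lemma extMap_comp_eq_zero (i : ℕ) (x : Ext A (ModuleCat.of R X) i) :
    extMap A g i (extMap A f i x) = 0 := by
  have : ModuleCat.ofHom f ≫ ModuleCat.ofHom g = 0 := h.complex.zero
  simp [this]

include h in
lemma extMap_exact (i : ℕ) : Function.Exact (extMap A f i) (extMap A g i) := fun y =>
  ⟨fun hy => Ext.covariant_sequence_exact₂ A h.shortExact y hy, by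
    rintro ⟨x, rfl⟩; exact extMap_comp_eq_zero h i x⟩

lemma extMap_extδ_exact (i : ℕ) : Function.Exact (extMap A g i) (extδ A h i) := fun y =>
  ⟨fun hy => Ext.covariant_sequence_exact₃ A h.shortExact y rfl hy, by
    rintro ⟨x, rfl⟩
    have := h.shortExact.comp_extClass
    dsimp at this
    rw [extMap_apply, extδ_apply, Ext.comp_assoc _ _ _ (add_zero i) (zero_add 1) (by omega), this,
      Ext.comp_zero]⟩

lemma extδ_extMap_exact (i : ℕ) : Function.Exact (extδ A h i) (extMap A f (i + 1)) := fun y =>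
  ⟨fun hy => Ext.covariant_sequence_exact₁ A h.shortExact y hy rfl, by
    rintro ⟨x, rfl⟩
    have := h.shortExact.extClass_comp
    dsimp at this
    rw [extMap_apply, extδ_apply, Ext.comp_assoc _ _ _ rfl (add_zero 1) (by omega), this,
      Ext.comp_zero]⟩

lemma extMap_zero_injective (hf : Function.Injective f) : Function.Injective (extMap A f 0) :=
  have : Mono (ModuleCat.ofHom f) := (ModuleCat.mono_iff_injective _).2 hf
  Ext.postcomp_mk₀_injective_of_mono A (ModuleCat.ofHom f)

lemma subsingleton_ext_of_injective [Module.Injective R Y] (i : ℕ) :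
    Subsingleton (Ext A (ModuleCat.of R Y) (i + 1)) :=
  have := Module.injective_object_of_injective_module R Y
  ⟨fun a b => by rw [Ext.eq_zero_of_injective a, Ext.eq_zero_of_injective b]⟩

end Ext

/-! ### Exactness of sequential direct limits. -/

section DirectLimit

variable {A B C : ℕ → Type u} [∀ i, AddCommGroup (A i)] [∀ i, AddCommGroup (B i)]
  [∀ i, AddCommGroup (C i)] [∀ i, Module R (A i)] [∀ i, Module R (B i)] [∀ i, Module R (C i)]
  {a : ∀ i j, i ≤ j → A i →ₗ[R] A j} {b : ∀ i j, i ≤ j → B i →ₗ[R] B j}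
  {c : ∀ i j, i ≤ j → C i →ₗ[R] C j} [DirectedSystem C (fun i j h => c i j h)]

/-- An element that dies in the limit already dies at a finite stage, where exactness supplies a
preimage. -/
lemma directLimit_map_exact (f : ∀ i, A i →ₗ[R] B i) (g : ∀ i, B i →ₗ[R] C i)
    (hf : ∀ i j h, f j ∘ₗ a i j h = b i j h ∘ₗ f i)
    (hg : ∀ i j h, g j ∘ₗ b i j h = c i j h ∘ₗ g i)
    (hfg : ∀ i, Function.Exact (f i) (g i)) :
    Function.Exact (Module.DirectLimit.map f hf) (Module.DirectLimit.map g hg) := by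
  intro y
  constructor
  · intro hy
    obtain ⟨i, y, rfl⟩ := Module.DirectLimit.exists_of y
    rw [Module.DirectLimit.map_apply_of] at hy
    obtain ⟨j, hij, hj⟩ := Module.DirectLimit.of.zero_exact hy
    have h1 : g j (b i j hij y) = 0 := by rw [← hj]; exact LinearMap.congr_fun (hg i j hij) y
    obtain ⟨x, hx⟩ := (hfg j _).1 h1
    exact ⟨Module.DirectLimit.of _ _ _ _ j x, by
      rw [Module.DirectLimit.map_apply_of, hx, Module.DirectLimit.of_f]⟩
  · rintro ⟨x, rfl⟩
    obtain ⟨i, x, rfl⟩ := Module.DirectLimit.exists_of x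
    rw [Module.DirectLimit.map_apply_of, Module.DirectLimit.map_apply_of,
      (hfg i).apply_apply_eq_zero, map_zero]

end DirectLimit

/-! ### Functoriality and the long exact sequence of generalized local cohomology. -/

section Functoriality

variable (I : Ideal R) (M : Type u) [AddCommGroup M] [Module R M]
  {X Y Z : Type u} [AddCommGroup X] [Module R X]
  [AddCommGroup Y] [Module R Y] [AddCommGroup Z] [Module R Z]

lemma extMap_extTransition (f : X →ₗ[R] Y) (i p q : ℕ) (h : p ≤ q) :
    extMap _ f i ∘ₗ extTransition I M X i p q h =
      extTransition I M Y i p q h ∘ₗ extMap _ f i := by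
  ext x
  simp [extTransition]

lemma extδ_extTransition {f : X →ₗ[R] Y} {g : Y →ₗ[R] Z} (hs : IsSES f g) (i p q : ℕ)
    (h : p ≤ q) :
    extδ _ hs i ∘ₗ extTransition I M Z i p q h =
      extTransition I M X (i + 1) p q h ∘ₗ extδ _ hs i := by
  ext x
  simp only [extTransition, LinearMap.comp_apply]
  exact Ext.comp_assoc _ _ _ (zero_add i) rfl (by omega)

/-- The map `H^i_I(M, X) → H^i_I(M, Y)` induced by a linear map `X → Y`. -/
def lcMap (f : X →ₗ[R] Y) (i : ℕ) :
    genLocalCohomology I M X i →ₗ[R] genLocalCohomology I M Y i :=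
  Module.DirectLimit.map (fun _ => extMap _ f i) (extMap_extTransition I M f i)

/-- The connecting map `H^i_I(M, Z) → H^{i+1}_I(M, X)` of a short exact sequence. -/
def lcδ {f : X →ₗ[R] Y} {g : Y →ₗ[R] Z} (hs : IsSES f g) (i : ℕ) :
    genLocalCohomology I M Z i →ₗ[R] genLocalCohomology I M X (i + 1) :=
  Module.DirectLimit.map (fun _ => extδ _ hs i) (extδ_extTransition I M hs i)

lemma lcMap_of (f : X →ₗ[R] Y) (i q : ℕ) (x : Ext (powQuot I M q) (ModuleCat.of R X) i) :
    lcMap I M f i (Module.DirectLimit.of _ _ _ (extTransition I M X i) q x) =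
      Module.DirectLimit.of _ _ _ (extTransition I M Y i) q (extMap _ f i x) :=
  Module.DirectLimit.map_apply_of _ _ _

lemma lcMap_comp_apply (f : X →ₗ[R] Y) (g : Y →ₗ[R] Z) (i : ℕ) (x) :
    lcMap I M g i (lcMap I M f i x) = lcMap I M (g ∘ₗ f) i x := by
  obtain ⟨q, x, rfl⟩ := Module.DirectLimit.exists_of x
  simp [lcMap_of]

lemma lcMap_id_apply (i : ℕ) (x) : lcMap I M (LinearMap.id : X →ₗ[R] X) i x = x := by
  obtain ⟨q, x, rfl⟩ := Module.DirectLimit.exists_of x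
  simp [lcMap_of]

/-- Isomorphic coefficient modules have isomorphic generalized local cohomology. -/
def lcCongr (e : X ≃ₗ[R] Y) (i : ℕ) : genLocalCohomology I M X i ≃ₗ[R] genLocalCohomology I M Y i :=
  LinearEquiv.ofLinearMap (lcMap I M e i) (lcMap I M e.symm i)
    (LinearMap.ext fun x => by simp [lcMap_comp_apply, lcMap_id_apply])
    (LinearMap.ext fun x => by simp [lcMap_comp_apply, lcMap_id_apply])

variable {I M} {f : X →ₗ[R] Y} {g : Y →ₗ[R] Z}

lemma IsSES.lcMap_exact (hs : IsSES f g) (i : ℕ) :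
    Function.Exact (lcMap I M f i) (lcMap I M g i) :=
  directLimit_map_exact _ _ _ _ fun _ => extMap_exact hs i

lemma IsSES.lcMap_lcδ_exact (hs : IsSES f g) (i : ℕ) :
    Function.Exact (lcMap I M g i) (lcδ I M hs i) :=
  directLimit_map_exact _ _ _ _ fun _ => extMap_extδ_exact hs i

lemma IsSES.lcδ_lcMap_exact (hs : IsSES f g) (i : ℕ) :
    Function.Exact (lcδ I M hs i) (lcMap I M f (i + 1)) :=
  directLimit_map_exact _ _ _ _ fun _ => extδ_extMap_exact hs i

lemma subsingleton_lc_of_ext {i : ℕ}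
    (h : ∀ q, Subsingleton (Ext (powQuot I M q) (ModuleCat.of R X) i)) :
    Subsingleton (genLocalCohomology I M X i) := by
  refine subsingleton_of_forall_eq 0 fun x => ?_
  obtain ⟨q, x, rfl⟩ := Module.DirectLimit.exists_of x
  rw [Subsingleton.elim x 0, map_zero]

variable (I M) in
lemma subsingleton_lc_of_injective [Module.Injective R X] (i : ℕ) :
    Subsingleton (genLocalCohomology I M X (i + 1)) :=
  subsingleton_lc_of_ext fun _ => subsingleton_ext_of_injective i

variable (I M X) in
lemma subsingleton_lc_of_subsingleton [Subsingleton X] (i : ℕ) :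
    Subsingleton (genLocalCohomology I M X i) := by
  refine subsingleton_of_forall_eq 0 fun x => ?_
  rw [← lcMap_id_apply I M i x, Subsingleton.elim (LinearMap.id : X →ₗ[R] X) 0]
  obtain ⟨q, x, rfl⟩ := Module.DirectLimit.exists_of x
  have : (ModuleCat.ofHom (0 : X →ₗ[R] X)) = 0 := rfl
  simp [lcMap_of, this]

end Functoriality

/-! ### Elementary consequences of exactness. -/

section ExactConsequences

variable {A B C : Type u} [AddCommGroup A] [Module R A]
  [AddCommGroup B] [Module R B] [AddCommGroup C] [Module R C]

lemma subsingleton_of_exact {f : A →ₗ[R] B} {g : B →ₗ[R] C} (h : Function.Exact f g)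
    (hA : Subsingleton A) (hC : Subsingleton C) : Subsingleton B := by
  refine subsingleton_of_forall_eq 0 fun b => ?_
  obtain ⟨a, rfl⟩ := (h b).1 (Subsingleton.elim _ _)
  rw [Subsingleton.elim a 0, map_zero]

lemma injective_of_exact {f : A →ₗ[R] B} {g : B →ₗ[R] C} (h : Function.Exact f g)
    (hA : Subsingleton A) : Function.Injective g := by
  rw [injective_iff_map_eq_zero]
  intro b hb
  obtain ⟨a, rfl⟩ := (h b).1 hb
  rw [Subsingleton.elim a 0, map_zero]

lemma surjective_of_exact {f : A →ₗ[R] B} {g : B →ₗ[R] C} (h : Function.Exact f g)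
    (hC : Subsingleton C) : Function.Surjective f :=
  fun b => (h b).1 (Subsingleton.elim _ _)

/-- Two surjections whose kernels correspond under an isomorphism of the sources have isomorphic
targets. -/
def equivOfSurjective {B' C' : Type u} [AddCommGroup B'] [Module R B'] [AddCommGroup C']
    [Module R C'] {g : B →ₗ[R] C} {g' : B' →ₗ[R] C'} (hg : Function.Surjective g)
    (hg' : Function.Surjective g') (e : B ≃ₗ[R] B') (h : ∀ b, g b = 0 ↔ g' (e b) = 0) :
    C ≃ₗ[R] C' :=
  (g.quotKerEquivOfSurjective hg).symm ≪≫ₗ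
    Submodule.Quotient.equiv _ _ e (by
      ext b
      constructor
      · rintro ⟨a, ha, rfl⟩; exact (h a).1 ha
      · intro hb; exact ⟨e.symm b, (h _).2 (by simpa using hb), by simp⟩) ≪≫ₗ
    g'.quotKerEquivOfSurjective hg'

end ExactConsequences

/-! ### Two-out-of-three vanishing and dimension shifting. -/

section Shift

variable {I : Ideal R} {M : Type u} [AddCommGroup M] [Module R M]
  {X Y Z : Type u} [AddCommGroup X] [Module R X]
  [AddCommGroup Y] [Module R Y] [AddCommGroup Z] [Module R Z]
  {f : X →ₗ[R] Y} {g : Y →ₗ[R] Z}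

lemma IsSES.subsingleton_mid (hs : IsSES f g) {i : ℕ}
    (hX : Subsingleton (genLocalCohomology I M X i))
    (hZ : Subsingleton (genLocalCohomology I M Z i)) :
    Subsingleton (genLocalCohomology I M Y i) :=
  subsingleton_of_exact (hs.lcMap_exact i) hX hZ

lemma IsSES.subsingleton_right (hs : IsSES f g) {i : ℕ}
    (hY : Subsingleton (genLocalCohomology I M Y i))
    (hX : Subsingleton (genLocalCohomology I M X (i + 1))) :
    Subsingleton (genLocalCohomology I M Z i) :=
  subsingleton_of_exact (hs.lcMap_lcδ_exact i) hY hX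

lemma IsSES.subsingleton_left (hs : IsSES f g) {i : ℕ}
    (hZ : Subsingleton (genLocalCohomology I M Z i))
    (hY : Subsingleton (genLocalCohomology I M Y (i + 1))) :
    Subsingleton (genLocalCohomology I M X (i + 1)) :=
  subsingleton_of_exact (hs.lcδ_lcMap_exact i) hZ hY

/-- The connecting isomorphism when the middle term is acyclic. -/
def IsSES.shiftEquiv (hs : IsSES f g) {i : ℕ} (h : Subsingleton (genLocalCohomology I M Y i))
    (h' : Subsingleton (genLocalCohomology I M Y (i + 1))) :
    genLocalCohomology I M Z i ≃ₗ[R] genLocalCohomology I M X (i + 1) :=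
  LinearEquiv.ofBijective (lcδ I M hs i) ⟨injective_of_exact (hs.lcMap_lcδ_exact i) h,
    surjective_of_exact (hs.lcδ_lcMap_exact i) h'⟩

/-- The isomorphism onto the cohomology of the quotient when the submodule is acyclic. -/
def IsSES.quotEquiv (hs : IsSES f g) {i : ℕ} (h : Subsingleton (genLocalCohomology I M X i))
    (h' : Subsingleton (genLocalCohomology I M X (i + 1))) :
    genLocalCohomology I M Y i ≃ₗ[R] genLocalCohomology I M Z i :=
  LinearEquiv.ofBijective (lcMap I M g i) ⟨injective_of_exact (hs.lcMap_exact i) h,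
    surjective_of_exact (hs.lcMap_lcδ_exact i) h'⟩

/-- Dimension shifting for `Ext` along an embedding into an injective module. -/
def IsSES.extShiftEquiv (hs : IsSES f g) [Module.Injective R Y] (A : ModuleCat.{u} R) (i : ℕ) :
    Ext A (ModuleCat.of R Z) (i + 1) ≃ₗ[R] Ext A (ModuleCat.of R X) (i + 2) :=
  LinearEquiv.ofBijective (extδ A hs (i + 1))
    ⟨injective_of_exact (extMap_extδ_exact hs _) (subsingleton_ext_of_injective i),
    surjective_of_exact (extδ_extMap_exact hs _) (subsingleton_ext_of_injective (i + 1))⟩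

variable (R X) in
/-- Every module embeds into an injective module. -/
lemma exists_injective_embedding : ∃ (E : Type u) (_ : AddCommGroup E) (_ : Module R E)
    (f : X →ₗ[R] E), Module.Injective R E ∧ Function.Injective f := by
  have : EnoughInjectives (ModuleCat.{u} R) := inferInstance
  obtain ⟨⟨J, hJ, f, hf⟩⟩ := this.presentation (ModuleCat.of R X)
  exact ⟨J, inferInstance, inferInstance, f.hom,
    @Module.injective_module_of_injective_object R J _ _ _ hJ, (ModuleCat.mono_iff_injective _).1 hf⟩

end Shift

section EquivOfRangeEq

variable {A B C : Type u} [AddCommGroup A] [Module R A]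
  [AddCommGroup B] [Module R B] [AddCommGroup C] [Module R C]
  {f : A →ₗ[R] C} {g : B →ₗ[R] C}

/-- Two injective maps with the same range have isomorphic sources. -/
def equivOfRangeEq (hf : Function.Injective f) (hg : Function.Injective g)
    (h : LinearMap.range f = LinearMap.range g) : A ≃ₗ[R] B :=
  LinearEquiv.ofInjective f hf ≪≫ₗ LinearEquiv.ofEq _ _ h ≪≫ₗ (LinearEquiv.ofInjective g hg).symm

lemma apply_equivOfRangeEq (hf : Function.Injective f) (hg : Function.Injective g)
    (h : LinearMap.range f = LinearMap.range g) (a : A) : g (equivOfRangeEq hf hg h a) = f a :=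
  congrArg Subtype.val ((LinearEquiv.ofInjective g hg).apply_symm_apply
    (LinearEquiv.ofEq _ _ h (LinearEquiv.ofInjective f hf a)))

end EquivOfRangeEq

/-! ### The I-power torsion submodule. -/

section PowTorsion

/-- The submodule of elements killed by some power of `I`. -/
def powTorsion (I : Ideal R) (X : Type u) [AddCommGroup X] [Module R X] : Submodule R X where
  carrier := {x | ∃ q : ℕ, ∀ a ∈ I ^ q, a • x = 0}
  zero_mem' := ⟨0, fun a _ => smul_zero a⟩
  add_mem' := by
    rintro x y ⟨p, hp⟩ ⟨q, hq⟩
    refine ⟨max p q, fun a ha => ?_⟩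
    rw [smul_add, hp a (Ideal.pow_le_pow_right (le_max_left p q) ha),
      hq a (Ideal.pow_le_pow_right (le_max_right p q) ha), add_zero]
  smul_mem' := by
    rintro r x ⟨q, hq⟩
    exact ⟨q, fun a ha => by rw [smul_comm, hq a ha, smul_zero]⟩

variable {I : Ideal R} {X Y : Type u} [AddCommGroup X] [Module R X] [AddCommGroup Y] [Module R Y]

lemma mem_powTorsion {x : X} : x ∈ powTorsion I X ↔ ∃ q : ℕ, ∀ a ∈ I ^ q, a • x = 0 := Iff.rfl

end PowTorsion

/-! ### Degree zero: H^0_I(M,X) as the I-power torsion of Hom(M,X). -/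

section DegreeZero

variable (I : Ideal R) (M : Type u) [AddCommGroup M] [Module R M]
  {X Y : Type u} [AddCommGroup X] [Module R X] [AddCommGroup Y] [Module R Y]

variable (X) in
/-- `Ext^0(M, X)` is `Hom(M, X)`. -/
def extZeroEquiv : Ext (ModuleCat.of R M) (ModuleCat.of R X) 0 ≃ₗ[R] (M →ₗ[R] X) :=
  Ext.linearEquiv₀ ≪≫ₗ ModuleCat.homLinearEquiv

variable {M} in
lemma extZeroEquiv_mk₀ (f : M →ₗ[R] X) : extZeroEquiv M X (Ext.mk₀ (ModuleCat.ofHom f)) = f := by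
  have : Ext.linearEquiv₀ (R := R) (Ext.mk₀ (ModuleCat.ofHom f)) = ModuleCat.ofHom f :=
    Ext.homEquiv₀.apply_symm_apply _
  rw [extZeroEquiv, LinearEquiv.trans_apply, this]; rfl

variable {M} in
lemma mk₀_extZeroEquiv (x : Ext (ModuleCat.of R M) (ModuleCat.of R X) 0) :
    Ext.mk₀ (ModuleCat.ofHom (extZeroEquiv M X x)) = x :=
  (extZeroEquiv M X).injective (extZeroEquiv_mk₀ _)

variable {M} in
lemma extZeroEquiv_extMap (f : X →ₗ[R] Y) (x : Ext (ModuleCat.of R M) (ModuleCat.of R X) 0) :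
    extZeroEquiv M Y (extMap _ f 0 x) = f ∘ₗ extZeroEquiv M X x := by
  obtain ⟨g, rfl⟩ := (extZeroEquiv M X).symm.surjective x
  obtain ⟨x, rfl⟩ := (extZeroEquiv M X).surjective g
  rw [LinearEquiv.symm_apply_apply, ← extZeroEquiv_mk₀ (f ∘ₗ extZeroEquiv M X x)]
  congr 1
  conv_lhs => rw [← mk₀_extZeroEquiv x]
  simp

lemma extZeroEquiv_extTransition (p q : ℕ) (h : p ≤ q)
    (x : Ext (powQuot I M p) (ModuleCat.of R X) 0) :
    extZeroEquiv _ X (extTransition I M X 0 p q h x) =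
      extZeroEquiv _ X x ∘ₗ (powQuotMap I M h).hom := by
  rw [← extZeroEquiv_mk₀ (extZeroEquiv _ X x ∘ₗ (powQuotMap I M h).hom)]
  congr 1
  conv_lhs => rw [← mk₀_extZeroEquiv x]
  simp [extTransition]

variable (X) in
/-- The natural map `H^0_I(M, X) → Hom(M, X)`. -/
def lcToHom : genLocalCohomology I M X 0 →ₗ[R] (M →ₗ[R] X) :=
  Module.DirectLimit.lift _ _ _ _
    (fun q => LinearMap.lcomp R X (I ^ q • ⊤ : Submodule R M).mkQ ∘ₗ
      (extZeroEquiv (M ⧸ (I ^ q • ⊤ : Submodule R M)) X).toLinearMap) (by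
    intro p q h x
    ext m
    simp only [LinearMap.comp_apply, LinearEquiv.coe_coe, extZeroEquiv_extTransition]
    rfl)

lemma lcToHom_of (q : ℕ) (x : Ext (powQuot I M q) (ModuleCat.of R X) 0) :
    lcToHom I M X (Module.DirectLimit.of _ _ _ (extTransition I M X 0) q x) =
      extZeroEquiv _ X x ∘ₗ (I ^ q • ⊤ : Submodule R M).mkQ := by
  simp only [lcToHom, Module.DirectLimit.lift_of]; rfl

lemma lcToHom_lcMap (f : X →ₗ[R] Y) (x : genLocalCohomology I M X 0) :
    lcToHom I M Y (lcMap I M f 0 x) = f ∘ₗ lcToHom I M X x := by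
  obtain ⟨q, x, rfl⟩ := Module.DirectLimit.exists_of x
  rw [lcMap_of, lcToHom_of, lcToHom_of, extZeroEquiv_extMap, LinearMap.comp_assoc]

lemma lcToHom_injective : Function.Injective (lcToHom I M X) := by
  rw [injective_iff_map_eq_zero]
  intro x hx
  obtain ⟨q, x, rfl⟩ := Module.DirectLimit.exists_of x
  rw [lcToHom_of] at hx
  have : extZeroEquiv _ X x = 0 := by
    ext m; exact LinearMap.congr_fun hx m
  rw [(extZeroEquiv _ X).map_eq_zero_iff.1 this, map_zero]

/-- A map on M factors through M/I^qM exactly when I^q annihilates it. -/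
lemma range_lcToHom : LinearMap.range (lcToHom I M X) = powTorsion I (M →ₗ[R] X) := by
  ext f
  constructor
  · rintro ⟨x, rfl⟩
    obtain ⟨q, x, rfl⟩ := Module.DirectLimit.exists_of x
    refine ⟨q, fun a ha => ?_⟩
    ext m
    rw [lcToHom_of, LinearMap.smul_apply, ← map_smul, LinearMap.comp_apply, Submodule.mkQ_apply,
      (Submodule.Quotient.mk_eq_zero _).2 (Submodule.smul_mem_smul ha Submodule.mem_top), map_zero,
      LinearMap.zero_apply]
  · rintro ⟨q, hq⟩
    have h : (I ^ q • ⊤ : Submodule R M) ≤ LinearMap.ker f := by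
      rw [Submodule.smul_le]
      intro a ha m _
      rw [LinearMap.mem_ker, map_smul]
      exact LinearMap.congr_fun (hq a ha) m
    refine ⟨Module.DirectLimit.of _ _ _ (extTransition I M X 0) q
      ((extZeroEquiv _ X).symm (Submodule.liftQ _ f h)), ?_⟩
    rw [lcToHom_of, LinearEquiv.apply_symm_apply, Submodule.liftQ_mkQ]

variable (X) in
/-- The natural map `H^0_I(X) → X`. -/
def lcEval : localCohomologyModule I X 0 →ₗ[R] X :=
  (LinearMap.ringLmapEquivSelf R R X).toLinearMap ∘ₗ lcToHom I R X

lemma lcEval_lcMap (f : X →ₗ[R] Y) (x : localCohomologyModule I X 0) :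
    lcEval I Y (lcMap I R f 0 x) = f (lcEval I X x) := by
  simp [lcEval, lcToHom_lcMap]

lemma lcEval_injective : Function.Injective (lcEval I X) :=
  (LinearMap.ringLmapEquivSelf R R X).injective.comp (lcToHom_injective I R)

lemma range_lcEval : LinearMap.range (lcEval I X) = powTorsion I X := by
  rw [lcEval, LinearMap.range_comp, range_lcToHom]
  ext x
  constructor
  · rintro ⟨f, ⟨q, hq⟩, rfl⟩
    exact ⟨q, fun a ha => LinearMap.congr_fun (hq a ha) 1⟩
  · rintro ⟨q, hq⟩
    refine ⟨(LinearMap.ringLmapEquivSelf R R X).symm x, ⟨q, fun a ha => ?_⟩, by simp⟩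
    rw [← map_smul, hq a ha, map_zero]

/-- Turns vanishing of H^1, a cokernel in degree zero, into lifting of torsion elements. -/
lemma lcMap_zero_surjective_iff {f : X →ₗ[R] Y} : Function.Surjective (lcMap I R f 0) ↔
    ∀ y ∈ powTorsion I Y, ∃ x ∈ powTorsion I X, f x = y := by
  simp only [← range_lcEval]
  constructor
  · rintro h _ ⟨y, rfl⟩
    obtain ⟨x, rfl⟩ := h y
    exact ⟨_, ⟨x, rfl⟩, (lcEval_lcMap I f x).symm⟩
  · intro h y
    obtain ⟨_, ⟨x, rfl⟩, hx⟩ := h _ ⟨y, rfl⟩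
    exact ⟨x, lcEval_injective I (by rw [lcEval_lcMap, hx])⟩

lemma powTorsion_equiv (e : X ≃ₗ[R] Y) (x : X) : e x ∈ powTorsion I Y ↔ x ∈ powTorsion I X := by
  simp only [mem_powTorsion, ← map_smul, LinearEquiv.map_eq_zero_iff]

lemma range_extZeroEquiv_lcEval :
    LinearMap.range (lcToHom I M X) =
      LinearMap.range ((extZeroEquiv M X).toLinearMap ∘ₗ lcEval I _) := by
  rw [range_lcToHom, LinearMap.range_comp, range_lcEval]
  ext f
  constructor
  · intro hf
    exact ⟨(extZeroEquiv M X).symm f, (powTorsion_equiv _ _ _).2 hf, by simp⟩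
  · rintro ⟨x, hx, rfl⟩
    exact (powTorsion_equiv _ _ _).2 hx

variable (X) in
/-- The natural isomorphism `H^0_I(M, X) ≅ H^0_I(Hom(M, X))`. -/
def lcZeroEquiv : genLocalCohomology I M X 0 ≃ₗ[R]
    localCohomologyModule I (Ext (ModuleCat.of R M) (ModuleCat.of R X) 0) 0 :=
  equivOfRangeEq (lcToHom_injective I M)
    (g := (extZeroEquiv M X).toLinearMap ∘ₗ lcEval I _)
    ((extZeroEquiv M X).injective.comp (lcEval_injective I)) (range_extZeroEquiv_lcEval I M)

lemma lcEval_lcZeroEquiv (x : genLocalCohomology I M X 0) :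
    extZeroEquiv M X (lcEval I _ (lcZeroEquiv I M X x)) = lcToHom I M X x :=
  apply_equivOfRangeEq (lcToHom_injective I M)
    (g := (extZeroEquiv M X).toLinearMap ∘ₗ lcEval I _)
    ((extZeroEquiv M X).injective.comp (lcEval_injective I)) (range_extZeroEquiv_lcEval I M) x

/-- Naturality in X is what lets the kernels of connecting maps be compared in
`IsSES.lcδ_eq_zero_iff`. -/
lemma lcZeroEquiv_lcMap (f : X →ₗ[R] Y) (x : genLocalCohomology I M X 0) :
    lcZeroEquiv I M Y (lcMap I M f 0 x) =
      lcMap I R (extMap (ModuleCat.of R M) f 0) 0 (lcZeroEquiv I M X x) := by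
  apply lcEval_injective
  apply (extZeroEquiv M Y).injective
  rw [lcEval_lcZeroEquiv, lcEval_lcMap, extZeroEquiv_extMap, lcEval_lcZeroEquiv, lcToHom_lcMap]

end DegreeZero

/-! ### Extending torsion maps into injective modules. -/

section InjectiveModules

variable {X Y E : Type u} [AddCommGroup X] [Module R X] [AddCommGroup Y] [Module R Y]
  [AddCommGroup E] [Module R E]

lemma injective_of_equiv (e : X ≃ₗ[R] Y) [Module.Injective R X] : Module.Injective R Y :=
  (Module.Baer.of_equiv e (Module.Baer.of_injective inferInstance)).injective

lemma exists_comp_eq_of_ker_le [Module.Injective R E] (j : X →ₗ[R] Y) (f : X →ₗ[R] E)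
    (h : LinearMap.ker j ≤ LinearMap.ker f) : ∃ g : Y →ₗ[R] E, g ∘ₗ j = f := by
  obtain ⟨g, hg⟩ := Module.Injective.extension_property R E _ _
    ((LinearMap.ker j).liftQ j le_rfl)
    (LinearMap.ker_eq_bot.1 (Submodule.ker_liftQ_eq_bot _ _ _ le_rfl))
    ((LinearMap.ker j).liftQ f h)
  refine ⟨g, ?_⟩
  ext x
  exact LinearMap.congr_fun hg (Submodule.Quotient.mk x)

/-- A map from a submodule to an injective module which is killed by a power of `I` extends to a map
which is killed by a power of `I` (a consequence of the Artin-Rees lemma). -/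
lemma exists_extension_powTorsion [IsNoetherianRing R] [Module.Finite R X] [Module.Injective R E]
    (I : Ideal R) (K : Submodule R X) (f : K →ₗ[R] E) (hf : f ∈ powTorsion I (K →ₗ[R] E)) :
    ∃ g ∈ powTorsion I (X →ₗ[R] E), g ∘ₗ K.subtype = f := by
  obtain ⟨q, hq⟩ := hf
  -- Artin-Rees: I^{q+k}X ∩ K = I^q(I^kX ∩ K) ⊆ I^qK ⊆ ker f. So f factors through the image of K in
  -- X/I^{q+k}X, and an extension from there is killed by I^{q+k}.
  obtain ⟨k, hk⟩ := I.exists_pow_inf_eq_pow_smul K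
  have h := hk (q + k) (by omega)
  rw [Nat.add_sub_cancel] at h
  let S : Submodule R X := I ^ (q + k) • ⊤
  obtain ⟨g, hg⟩ := exists_comp_eq_of_ker_le (S.mkQ ∘ₗ K.subtype) f (by
    intro x hx
    have hxS : (x : X) ∈ S := by simpa using hx
    have hx' : (x : X) ∈ I ^ q • K :=
      by
      have hxK : (x : X) ∈ I ^ (q + k) • (⊤ : Submodule R X) ⊓ K := ⟨hxS, x.2⟩
      rw [h] at hxK
      exact (smul_mono_right (I ^ q) (inf_le_right : I ^ k • ⊤ ⊓ K ≤ K)) hxK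
    have hfK : I ^ q • K ≤ (LinearMap.ker f).map K.subtype := by
      rw [Submodule.smul_le]
      intro a ha y hy
      exact ⟨a • ⟨y, hy⟩, by
        rw [SetLike.mem_coe, LinearMap.mem_ker, map_smul]
        exact LinearMap.congr_fun (hq a ha) _, rfl⟩
    obtain ⟨z, hz, hzx⟩ := hfK hx'
    rwa [Subtype.ext hzx] at hz)
  refine ⟨g ∘ₗ S.mkQ, ⟨q + k, fun a ha => ?_⟩, hg⟩
  ext x
  rw [LinearMap.smul_apply, ← map_smul, LinearMap.comp_apply, Submodule.mkQ_apply,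
    (Submodule.Quotient.mk_eq_zero _).2 (Submodule.smul_mem_smul ha Submodule.mem_top), map_zero,
    LinearMap.zero_apply]

end InjectiveModules

/-! ### Acyclicity of Hom(M,E) for E injective. -/

section HomInjective

variable (I : Ideal R) (E : Type u) [AddCommGroup E] [Module R E]
  [Module.Injective R E]

lemma isSES_lcomp {X Y : Type u} [AddCommGroup X] [Module R X] [AddCommGroup Y] [Module R Y]
    {π : X →ₗ[R] Y} (hπ : Function.Surjective π) :
    IsSES (LinearMap.lcomp R E π) (LinearMap.lcomp R E (LinearMap.ker π).subtype) := by
  refine ⟨fun f g h => ?_, fun f => ⟨fun hf => ?_, ?_⟩, fun f => ?_⟩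
  · ext m
    obtain ⟨x, rfl⟩ := hπ m
    exact LinearMap.congr_fun h x
  · have hK : LinearMap.ker π ≤ LinearMap.ker f := fun x hx =>
      LinearMap.congr_fun hf (⟨x, hx⟩ : LinearMap.ker π)
    refine ⟨(LinearMap.ker π).liftQ f hK ∘ₗ (π.quotKerEquivOfSurjective hπ).symm, ?_⟩
    ext x
    simp [LinearMap.quotKerEquivOfSurjective_symm_apply]
  · rintro ⟨g, rfl⟩
    ext x
    have : π x = 0 := x.2
    simp [this]
  · exact Module.Injective.extension_property R E _ _ _ (Submodule.injective_subtype _) f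

variable [IsNoetherianRing R]

/-- For 0 → K → R^n → M → 0, the sequence 0 → Hom(M,E) → E^n → Hom(K,E) → 0 is exact with injective
middle term. Degrees above one shift down to K, again finitely generated. In degree one the
obstruction is lifting torsion maps from K to R^n, which `exists_extension_powTorsion` provides. -/
lemma subsingleton_lc_linearMap (p : ℕ) (M : Type u) [AddCommGroup M] [Module R M]
    [Module.Finite R M] : Subsingleton (localCohomologyModule I (M →ₗ[R] E) (p + 1)) := by
  have hfree (n : ℕ) : Module.Injective R ((Fin n → R) →ₗ[R] E) :=
    injective_of_equiv ((Pi.basisFun R (Fin n)).constr R (M' := E))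
  induction p generalizing M with
  | zero =>
    obtain ⟨n, π, hπ⟩ := Module.Finite.exists_fin' R M
    have := hfree n
    have hs := isSES_lcomp E hπ
    refine subsingleton_of_forall_eq 0 fun x => ?_
    obtain ⟨y, rfl⟩ := surjective_of_exact (hs.lcδ_lcMap_exact 0)
      (subsingleton_lc_of_injective I R 0) x
    obtain ⟨z, rfl⟩ := (lcMap_zero_surjective_iff I
      (f := LinearMap.lcomp R E (LinearMap.ker π).subtype)).2
      (fun f hf => exists_extension_powTorsion I _ f hf) y
    exact (hs.lcMap_lcδ_exact 0).apply_apply_eq_zero z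
  | succ p ih =>
    obtain ⟨n, π, hπ⟩ := Module.Finite.exists_fin' R M
    have := hfree n
    exact (isSES_lcomp E hπ).subsingleton_left (ih _) (subsingleton_lc_of_injective I R _)

lemma subsingleton_lc_extZero (p : ℕ) (M : Type u) [AddCommGroup M] [Module R M]
    [Module.Finite R M] :
    Subsingleton (localCohomologyModule I (Ext (ModuleCat.of R M) (ModuleCat.of R E) 0) (p + 1)) :=
  have := subsingleton_lc_linearMap I E p M
  (lcCongr I R (extZeroEquiv M E) (p + 1)).toEquiv.subsingleton

end HomInjective

/-! ### Torsion of injective modules and of sums of ideals. -/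

section TorsionInjective

variable {I : Ideal R} {M X E : Type u} [AddCommGroup M] [Module R M]
  [AddCommGroup X] [Module R X] [AddCommGroup E] [Module R E]

lemma mem_powTorsion_linearMap [Module.Finite R M] (f : M →ₗ[R] X)
    (hf : ∀ m, f m ∈ powTorsion I X) : f ∈ powTorsion I (M →ₗ[R] X) := by
  obtain ⟨s, hs⟩ := Module.Finite.fg_top (R := R) (M := M)
  choose q hq using hf
  refine ⟨s.sup q, fun a ha => LinearMap.ext_on hs fun m hm => ?_⟩
  exact hq m a (Ideal.pow_le_pow_right (Finset.le_sup hm) ha)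

/-- Baer's criterion: a map from an ideal J into the torsion of E has a uniform exponent, since J is
finitely generated. It therefore extends to a map R → E killed by a power of I, whose values are
again torsion. -/
lemma injective_powTorsion [IsNoetherianRing R] [Module.Injective R E] :
    Module.Injective R (powTorsion I E) := by
  refine Module.Baer.injective fun J g => ?_
  obtain ⟨h, ⟨q, hq⟩, hh⟩ := exists_extension_powTorsion I J ((powTorsion I E).subtype ∘ₗ g)
    (mem_powTorsion_linearMap _ fun m => (g m).2)
  refine ⟨h.codRestrict _ fun r => ⟨q, fun a ha => ?_⟩, fun r hr => Subtype.ext ?_⟩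
  · exact LinearMap.congr_fun (hq a ha) r
  · exact LinearMap.congr_fun hh ⟨r, hr⟩

lemma mem_powTorsion_span_singleton {x : R} {y : X} :
    y ∈ powTorsion (Ideal.span {x}) X ↔ ∃ q : ℕ, x ^ q • y = 0 := by
  simp only [mem_powTorsion, Ideal.span_singleton_pow, Ideal.mem_span_singleton]
  refine exists_congr fun q => ⟨fun h => h _ dvd_rfl, ?_⟩
  rintro h _ ⟨b, rfl⟩
  rw [mul_comm, mul_smul, h, smul_zero]

lemma powTorsion_sup {J : Ideal R} : powTorsion (I ⊔ J) X = powTorsion I X ⊓ powTorsion J X := by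
  ext y
  constructor
  · rintro ⟨q, hq⟩
    exact ⟨⟨q, fun a ha => hq a (Ideal.pow_right_mono le_sup_left q ha)⟩,
      ⟨q, fun a ha => hq a (Ideal.pow_right_mono le_sup_right q ha)⟩⟩
  · rintro ⟨⟨p, hp⟩, ⟨q, hq⟩⟩
    refine ⟨p + q, fun a ha => ?_⟩
    obtain ⟨b, hb, c, hc, rfl⟩ := Submodule.mem_sup.1 (Ideal.sup_pow_add_le_pow_sup_pow ha)
    rw [add_smul, hp b hb, hq c hc, add_zero]

end TorsionInjective

/-! ### Scalar actions on Ext. -/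

section Acyclicity

variable {A : ModuleCat.{u} R} {X : Type u} [AddCommGroup X] [Module R X]

lemma ext_smul_eq_zero_of_left {r : R} (h : ∀ a : A, r • a = 0) {i : ℕ}
    (e : Ext A (ModuleCat.of R X) i) : r • e = 0 := by
  have h0 : r • 𝟙 A = 0 := by ext a; exact h a
  rw [← Ext.mk₀_id_comp e, ← Ext.smul_comp, ← Ext.mk₀_smul, h0, Ext.mk₀_zero, Ext.zero_comp]

lemma ext_smul_eq_extMap (r : R) {i : ℕ} (e : Ext A (ModuleCat.of R X) i) :
    r • e = extMap A (LinearMap.lsmul R X r) i e := by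
  have h0 : ModuleCat.ofHom (LinearMap.lsmul R X r) = r • 𝟙 (ModuleCat.of R X) := rfl
  rw [extMap_apply, h0, Ext.mk₀_smul, Ext.comp_smul, Ext.comp_mk₀_id]

lemma ext_smul_eq_zero_of_right {r : R} (h : ∀ x : X, r • x = 0) {i : ℕ}
    (e : Ext A (ModuleCat.of R X) i) : r • e = 0 := by
  have h0 : LinearMap.lsmul R X r = 0 := by ext x; exact h x
  have h1 : (ModuleCat.ofHom (0 : X →ₗ[R] X)) = 0 := rfl
  rw [ext_smul_eq_extMap, h0, extMap_apply, h1, Ext.mk₀_zero, Ext.comp_zero]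

/-- On Ext^i(R/I^q, X) the scalar x^q acts as zero through the first argument and bijectively
through the second. -/
lemma subsingleton_lc_of_bijective_smul {I : Ideal R} {x : R} (hx : x ∈ I)
    (h : Function.Bijective fun y : X => x • y) (i : ℕ) :
    Subsingleton (localCohomologyModule I X i) := by
  refine subsingleton_lc_of_ext fun q => subsingleton_of_forall_eq 0 fun e => ?_
  have h0 : x ^ q • e = 0 := ext_smul_eq_zero_of_left (fun a => by
    obtain ⟨a, rfl⟩ := Submodule.Quotient.mk_surjective _ a
    rw [← Submodule.Quotient.mk_smul, Submodule.Quotient.mk_eq_zero]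
    exact Submodule.smul_mem_smul (Ideal.pow_mem_pow hx q) Submodule.mem_top) e
  have hq : Function.Bijective (LinearMap.lsmul R X (x ^ q)) := by
    have : ⇑(LinearMap.lsmul R X (x ^ q)) = (fun y : X => x • y)^[q] := by
      ext y
      rw [smul_iterate]; rfl
    rw [this]
    exact h.iterate q
  let u := LinearEquiv.ofBijective _ hq
  rw [ext_smul_eq_extMap] at h0
  have h1 : ModuleCat.ofHom (LinearMap.lsmul R X (x ^ q)) ≫
      ModuleCat.ofHom u.symm.toLinearMap = 𝟙 _ := by
    ext y
    exact u.symm_apply_apply y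
  have h2 := congrArg (extMap _ u.symm.toLinearMap i) h0
  rw [map_zero] at h2
  rw [← h2]
  simp [h1]

end Acyclicity

/-! ### Vanishing above the number of generators. -/

section Vanishing

section InjectiveMiddle

variable {I : Ideal R} {M X Y Z : Type u} [AddCommGroup M] [Module R M] [AddCommGroup X]
  [Module R X] [AddCommGroup Y] [Module R Y] [AddCommGroup Z] [Module R Z]
  [Module.Injective R Y] {f : X →ₗ[R] Y} {g : Y →ₗ[R] Z}

lemma IsSES.lcδ_zero_surjective (hs : IsSES f g) : Function.Surjective (lcδ I M hs 0) :=
  surjective_of_exact (hs.lcδ_lcMap_exact 0) (subsingleton_lc_of_injective I M 0)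

lemma IsSES.subsingleton_one_iff (hs : IsSES f g) :
    Subsingleton (genLocalCohomology I M X 1) ↔ Function.Surjective (lcMap I M g 0) := by
  constructor
  · exact fun h => surjective_of_exact (hs.lcMap_lcδ_exact 0) h
  · intro h
    refine subsingleton_of_forall_eq 0 fun a => ?_
    obtain ⟨b, rfl⟩ := hs.lcδ_zero_surjective a
    obtain ⟨c, rfl⟩ := h b
    exact (hs.lcMap_lcδ_exact 0).apply_apply_eq_zero c

/-- Dimension shifting along an embedding into an injective module. -/
def IsSES.injectiveShiftEquiv (hs : IsSES f g) (i : ℕ) :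
    genLocalCohomology I M Z (i + 1) ≃ₗ[R] genLocalCohomology I M X (i + 2) :=
  hs.shiftEquiv (subsingleton_lc_of_injective I M i) (subsingleton_lc_of_injective I M (i + 1))

end InjectiveMiddle

lemma powTorsion_eq_top_of_injective {I : Ideal R} {X Y : Type u} [AddCommGroup X] [Module R X]
    [AddCommGroup Y] [Module R Y] {f : X →ₗ[R] Y} (hf : Function.Injective f)
    (h : ∀ x, f x ∈ powTorsion I Y) : powTorsion I X = ⊤ :=
  eq_top_iff.2 fun x _ => (h x).imp fun q hq a ha => hf (by rw [map_smul, hq a ha, map_zero])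

lemma powTorsion_eq_top_of_surjective {I : Ideal R} {X Y : Type u} [AddCommGroup X] [Module R X]
    [AddCommGroup Y] [Module R Y] {f : X →ₗ[R] Y} (hf : Function.Surjective f)
    (h : powTorsion I X = ⊤) : powTorsion I Y = ⊤ := by
  refine eq_top_iff.2 fun y _ => ?_
  obtain ⟨x, rfl⟩ := hf y
  obtain ⟨q, hq⟩ := h.ge (Submodule.mem_top (x := x))
  exact ⟨q, fun a ha => by rw [← map_smul, hq a ha, map_zero]⟩

variable [IsNoetherianRing R]

/-- A torsion module embeds into an injective torsion module. -/
lemma exists_injective_torsion_embedding {I : Ideal R} (Y : Type u) [AddCommGroup Y]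
    [Module R Y] (hY : powTorsion I Y = ⊤) : ∃ (T : Type u) (_ : AddCommGroup T) (_ : Module R T)
      (f : Y →ₗ[R] T), Module.Injective R T ∧ powTorsion I T = ⊤ ∧ Function.Injective f := by
  obtain ⟨E, _, _, f, _, hf⟩ := exists_injective_embedding R Y
  refine ⟨powTorsion I E, inferInstance, inferInstance, f.codRestrict _ fun y => ?_,
    injective_powTorsion,
    powTorsion_eq_top_of_injective (Submodule.injective_subtype _) fun y => y.2,
    fun a b h => hf (congrArg Subtype.val h)⟩
  obtain ⟨q, hq⟩ := hY.ge (Submodule.mem_top (x := y))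
  exact ⟨q, fun a ha => by rw [← map_smul, hq a ha, map_zero]⟩

/-- An I-torsion module embeds in an I-torsion injective with I-torsion cokernel. On I-torsion
modules the (J+I)-torsion and the J-torsion coincide, so the two vanishing statements agree in
degree one and shift together. -/
lemma subsingleton_lc_sup_iff {I J : Ideal R} (i : ℕ) (Y : Type u) [AddCommGroup Y]
    [Module R Y] (hY : powTorsion I Y = ⊤) :
    Subsingleton (localCohomologyModule (J ⊔ I) Y (i + 1)) ↔
      Subsingleton (localCohomologyModule J Y (i + 1)) := by
  induction i generalizing Y with
  | zero =>
    obtain ⟨T, _, _, f, _, hT, hf⟩ := exists_injective_torsion_embedding Y hY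
    have hs := isSES_mkQ_range hf
    rw [zero_add, hs.subsingleton_one_iff, hs.subsingleton_one_iff, lcMap_zero_surjective_iff,
      lcMap_zero_surjective_iff, powTorsion_sup, powTorsion_sup, hT,
      powTorsion_eq_top_of_surjective hs.surj hT, inf_top_eq, inf_top_eq]
  | succ i ih =>
    obtain ⟨T, _, _, f, _, hT, hf⟩ := exists_injective_torsion_embedding Y hY
    have hs := isSES_mkQ_range hf
    rw [← (hs.injectiveShiftEquiv (I := J ⊔ I) (M := R) i).toEquiv.subsingleton_congr,
      ← (hs.injectiveShiftEquiv (I := J) (M := R) i).toEquiv.subsingleton_congr]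
    exact ih _ (powTorsion_eq_top_of_surjective hs.surj hT)

omit [IsNoetherianRing R] in
-- Every element is torsion for the zero ideal, so H^0 is the identity functor, which is exact.
lemma subsingleton_lc_bot (i : ℕ) (Y : Type u) [AddCommGroup Y] [Module R Y] :
    Subsingleton (localCohomologyModule (⊥ : Ideal R) Y (i + 1)) := by
  have htop (Z : Type u) [AddCommGroup Z] [Module R Z] : powTorsion (⊥ : Ideal R) Z = ⊤ :=
    eq_top_iff.2 fun z _ => ⟨1, fun a ha => by
      rw [pow_one, Ideal.mem_bot] at ha
      rw [ha, zero_smul]⟩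
  induction i generalizing Y with
  | zero =>
    obtain ⟨T, _, _, f, _, hf⟩ := exists_injective_embedding R Y
    have hs := isSES_mkQ_range hf
    rw [zero_add, hs.subsingleton_one_iff, lcMap_zero_surjective_iff, htop, htop]
    exact fun y _ => (hs.surj y).imp fun x hx => ⟨trivial, hx⟩
  | succ i ih =>
    obtain ⟨T, _, _, f, _, hf⟩ := exists_injective_embedding R Y
    have := ih (T ⧸ LinearMap.range f)
    exact ((isSES_mkQ_range hf).injectiveShiftEquiv i).symm.toEquiv.subsingleton

/-- Adding an element to the ideal raises the cohomological dimension by at most one. -/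
lemma subsingleton_lc_sup_span_singleton {J : Ideal R} {n : ℕ}
    (h : ∀ i, n < i → ∀ (Y : Type u) [AddCommGroup Y] [Module R Y],
      Subsingleton (localCohomologyModule J Y i)) (x : R) {i : ℕ} (hi : n + 1 < i)
    (X : Type u) [AddCommGroup X] [Module R X] :
    Subsingleton (localCohomologyModule (J ⊔ Ideal.span {x}) X i) := by
  have htors (k : ℕ) (hk : n < k) (Y : Type u) [AddCommGroup Y] [Module R Y]
      (hY : powTorsion (Ideal.span {x}) Y = ⊤) :
      Subsingleton (localCohomologyModule (J ⊔ Ideal.span {x}) Y k) := by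
    obtain ⟨k, rfl⟩ := Nat.exists_eq_succ_of_ne_zero (by omega : k ≠ 0)
    exact (subsingleton_lc_sup_iff k Y hY).2 (h _ hk Y)
  -- X is compared with its localization X_x, which has no cohomology since x acts bijectively.
  -- Kernel and cokernel of X → X_x are x-torsion, hence controlled by J alone. The cokernel enters
  -- one degree lower, which costs the extra one in the bound.
  let S := Submonoid.powers x
  let f := LocalizedModule.mkLinearMap S X
  have hker : powTorsion (Ideal.span {x}) (LinearMap.ker f) = ⊤ := by
    refine eq_top_iff.2 fun y _ => mem_powTorsion_span_singleton.2 ?_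
    have hy : f y = f 0 := by rw [map_zero]; exact y.2
    obtain ⟨⟨_, q, rfl⟩, hc⟩ := IsLocalizedModule.exists_of_eq (S := S) hy
    exact ⟨q, Subtype.ext (by simpa [Submonoid.smul_def] using hc)⟩
  have hcoker : powTorsion (Ideal.span {x}) (LocalizedModule S X ⧸ LinearMap.range f) = ⊤ := by
    refine eq_top_iff.2 fun z _ => mem_powTorsion_span_singleton.2 ?_
    obtain ⟨z, rfl⟩ := Submodule.Quotient.mk_surjective _ z
    obtain ⟨⟨y, ⟨_, q, rfl⟩⟩, hy⟩ := IsLocalizedModule.surj S f z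
    refine ⟨q, ?_⟩
    rw [← Submodule.Quotient.mk_smul, Submodule.Quotient.mk_eq_zero]
    exact ⟨y, hy.symm⟩
  have hloc (k : ℕ) : Subsingleton (localCohomologyModule (J ⊔ Ideal.span {x})
      (LocalizedModule S X) k) := by
    refine subsingleton_lc_of_bijective_smul (x := x)
      (Ideal.mem_sup_right (Ideal.mem_span_singleton_self x)) ?_ k
    exact (Module.End.isUnit_iff _).1
      (IsLocalizedModule.map_units f (⟨x, Submonoid.mem_powers x⟩ : S))
  obtain ⟨i, rfl⟩ := Nat.exists_eq_succ_of_ne_zero (by omega : i ≠ 0)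
  have hrange : Subsingleton (localCohomologyModule (J ⊔ Ideal.span {x})
      (LinearMap.range f) (i + 1)) :=
    (isSES_mkQ (LinearMap.range f)).subsingleton_left (htors i (by omega) _ hcoker) (hloc _)
  exact (isSES_ker f.surjective_rangeRestrict).subsingleton_mid
    (htors _ (by omega) _ (by rwa [LinearMap.ker_rangeRestrict])) hrange

/-- Local cohomology vanishes above the number of generators of the ideal. -/
theorem subsingleton_lc_span (s : Finset R) {i : ℕ} (hi : s.card < i) (X : Type u)
    [AddCommGroup X] [Module R X] :
    Subsingleton (localCohomologyModule (Ideal.span (s : Set R)) X i) := by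
  classical
  induction s using Finset.induction_on generalizing i X with
  | empty =>
    obtain ⟨i, rfl⟩ := Nat.exists_eq_succ_of_ne_zero (by simpa using hi.ne' : i ≠ 0)
    rw [Finset.coe_empty, Ideal.span_empty]
    exact subsingleton_lc_bot i X
  | insert a s ha ih =>
    rw [Finset.card_insert_of_notMem ha] at hi
    rw [Finset.coe_insert, Ideal.span_insert, sup_comm]
    exact subsingleton_lc_sup_span_singleton (fun i hi Y => ih hi Y) a hi X

/-- The bound is uniform in X; this is what starts the descending induction in
`subsingleton_lc_of_support_subset`. -/
theorem exists_forall_subsingleton_lc (I : Ideal R) : ∃ n : ℕ, ∀ i, n < i →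
    ∀ (X : Type u) [AddCommGroup X] [Module R X], Subsingleton (localCohomologyModule I X i) := by
  obtain ⟨s, rfl⟩ := IsNoetherian.noetherian I
  exact ⟨s.card, fun i hi X => subsingleton_lc_span s hi X⟩

end Vanishing

/-! ### Local cohomology vanishing and supports. -/

section Support

/-- The fibre κ(p) ⊗ L is a nonzero vector space, so some functional gives a nonzero map L → κ(p).
As κ(p) is the localization of R/p at p and L is finitely presented, denominators can be cleared. -/
lemma exists_linearMap_quotient_ne_zero [IsNoetherianRing R] (L : Type u) [AddCommGroup L]
    [Module R L] [Module.Finite R L] (p : PrimeSpectrum R) (hp : p ∈ Module.support R L) :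
    ∃ h : L →ₗ[R] R ⧸ p.asIdeal, h ≠ 0 := by
  have := Module.finitePresentation_of_finite R L
  let K := p.asIdeal.ResidueField
  have hnt := (Module.mem_support_iff_nontrivial_residueField_tensorProduct p).1 hp
  obtain ⟨φ, hφ⟩ : ∃ φ : Module.Dual K (K ⊗[R] L), φ ≠ 0 := by
    obtain ⟨v, hv⟩ := exists_ne (0 : K ⊗[R] L)
    by_contra! hcon
    exact hv ((Module.forall_dual_apply_eq_zero_iff K v).1 fun φ => by rw [hcon φ]; rfl)
  let ψ : L →ₗ[R] K := φ.restrictScalars R ∘ₗ TensorProduct.mk R K L 1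
  have hψ : ψ ≠ 0 := by
    intro h0
    apply hφ
    ext l
    exact LinearMap.congr_fun h0 l
  have hS : Algebra.algebraMapSubmonoid (R ⧸ p.asIdeal) p.asIdeal.primeCompl =
      nonZeroDivisors (R ⧸ p.asIdeal) := by
    ext x
    obtain ⟨r, rfl⟩ := Ideal.Quotient.mk_surjective x
    rw [mem_nonZeroDivisors_iff_ne_zero, Ne, Ideal.Quotient.eq_zero_iff_mem]
    constructor
    · rintro ⟨s, hs, hsr⟩ hr
      exact hs (Ideal.Quotient.eq_zero_iff_mem.1 (hsr.trans (Ideal.Quotient.eq_zero_iff_mem.2 hr)))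
    · intro hr
      exact ⟨r, hr, rfl⟩
  have : IsLocalizedModule p.asIdeal.primeCompl
      (IsScalarTower.toAlgHom R (R ⧸ p.asIdeal) K).toLinearMap := by
    rw [isLocalizedModule_iff_isLocalization, hS]
    exact inferInstanceAs (IsFractionRing (R ⧸ p.asIdeal) K)
  obtain ⟨h, s, hs⟩ := Module.FinitePresentation.exists_lift_of_isLocalizedModule
    p.asIdeal.primeCompl (IsScalarTower.toAlgHom R (R ⧸ p.asIdeal) K).toLinearMap ψ
  refine ⟨h, ?_⟩
  rintro rfl
  apply hψ
  ext l
  have h1 : s • ψ l = 0 := by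
    have := LinearMap.congr_fun hs l
    simpa using this.symm
  refine ((Module.End.isUnit_iff _).1 (IsLocalizedModule.map_units
    (IsScalarTower.toAlgHom R (R ⧸ p.asIdeal) K).toLinearMap s)).1 ?_
  rw [LinearMap.zero_apply, map_zero]
  exact h1

/-- The vanishing of local cohomology from some degree on is determined by the support. -/
theorem subsingleton_lc_of_support_subset [IsNoetherianRing R] (I : Ideal R) (L : Type u)
    [AddCommGroup L] [Module R L] [Module.Finite R L] {c : ℕ}
    (hL : ∀ p, c ≤ p → Subsingleton (localCohomologyModule I L p)) (K : Type u)
    [AddCommGroup K] [Module R K] [Module.Finite R K]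
    (hK : Module.support R K ⊆ Module.support R L) {p : ℕ} (hp : c ≤ p) :
    Subsingleton (localCohomologyModule I K p) := by
  obtain ⟨n, hn⟩ := exists_forall_subsingleton_lc I
  -- Descending induction on p, with d bounding the distance to the range where all local cohomology
  -- vanishes.
  suffices H : ∀ d p : ℕ, c ≤ p → n + 1 ≤ p + d → ∀ (K : Type u) [AddCommGroup K] [Module R K]
      [Module.Finite R K], Module.support R K ⊆ Module.support R L →
      Subsingleton (localCohomologyModule I K p) from H (n + 1) p hp (by omega) K hK
  clear! K p
  intro d
  induction d with
  | zero => exact fun p _ h K _ _ _ _ => hn p (by omega) K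
  | succ d ihd =>
    intro p hp hd
    -- Within a fixed degree, Noetherian induction on a lower bound J of the annihilator; a prime
    -- filtration then reduces to K = R/P.
    suffices H : ∀ (J : Ideal R) (K : Type u) [AddCommGroup K] [Module R K]
        [Module.Finite R K], Module.support R K ⊆ Module.support R L → J ≤ Module.annihilator R K →
        Subsingleton (localCohomologyModule I K p) from fun K _ _ _ hK => H _ K hK le_rfl
    intro J
    induction J using IsNoetherian.induction with
    | hgt J ihJ =>
    intro K _ _ hfin
    refine IsNoetherianRing.induction_on_isQuotientEquivQuotientPrime R hfin
      (motive := fun N _ _ _ => Module.support R N ⊆ Module.support R L →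
        J ≤ Module.annihilator R N → Subsingleton (localCohomologyModule I N p)) ?_ ?_ ?_
    · intro N _ _ _ _ _ _
      exact subsingleton_lc_of_subsingleton I R N p
    · intro N _ _ _ P e hN hJ
      have hsupp : Module.support R (R ⧸ P.asIdeal) ⊆ Module.support R L := by
        rwa [← e.support_eq]
      have hann : J ≤ P.asIdeal := by
        rwa [e.annihilator_eq, Ideal.annihilator_quotient] at hJ
      obtain ⟨h, hh⟩ := exists_linearMap_quotient_ne_zero L P (hsupp (by
        rw [Module.support_eq_zeroLocus, Ideal.annihilator_quotient]; exact fun x hx => hx))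
      -- The image W of a nonzero map L → R/P is a quotient of L, so H^p(W) lies between H^p(L) = 0
      -- and H^{p+1}(ker h) = 0.
      have hW : Subsingleton (localCohomologyModule I (LinearMap.range h) p) :=
        (isSES_ker h.surjective_rangeRestrict).subsingleton_right (hL p hp)
          (ihd (p + 1) (by omega) (by omega) _
            (Module.support_subset_of_injective _ (Submodule.injective_subtype _)))
      have hs := isSES_mkQ (LinearMap.range h)
      have hlt : J < Module.annihilator R ((R ⧸ P.asIdeal) ⧸ LinearMap.range h) := by
        refine lt_of_le_of_lt hann (lt_of_le_of_ne ?_ ?_)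
        · conv_lhs => rw [← Ideal.annihilator_quotient (I := P.asIdeal)]
          exact LinearMap.annihilator_le_of_surjective _ hs.surj
        -- A lift a of a nonzero value h(l) kills (R/P)/W, because a·r̄ = h(r·l) in R/P; but a is
        -- not in P.
        · intro heq
          obtain ⟨l, hl⟩ : ∃ l, h l ≠ 0 := by
            by_contra! hcon
            exact hh (LinearMap.ext hcon)
          obtain ⟨a, ha⟩ := Ideal.Quotient.mk_surjective (h l)
          apply hl
          rw [← ha, Ideal.Quotient.eq_zero_iff_mem, heq, Module.mem_annihilator]
          intro z
          obtain ⟨z, rfl⟩ := Submodule.Quotient.mk_surjective _ z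
          obtain ⟨r, rfl⟩ := Ideal.Quotient.mk_surjective z
          rw [← Submodule.Quotient.mk_smul, Submodule.Quotient.mk_eq_zero]
          refine ⟨r • l, ?_⟩
          rw [map_smul, ← ha, Algebra.smul_def, Algebra.smul_def, mul_comm]
          rfl
      have hR := hs.subsingleton_mid hW (ihJ _ hlt _
        ((Module.support_subset_of_surjective _ hs.surj).trans hsupp) le_rfl)
      exact (lcCongr I R e p).toEquiv.subsingleton
    · intro N₁ _ _ _ N₂ _ _ _ N₃ _ _ _ f g hf hg hfg h₁ h₃ hN hJ
      exact IsSES.subsingleton_mid ⟨hf, hfg, hg⟩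
        (h₁ ((Module.support_subset_of_injective f hf).trans hN)
          (hJ.trans (LinearMap.annihilator_le_of_injective f hf)))
        (h₃ ((Module.support_subset_of_surjective g hg).trans hN)
          (hJ.trans (LinearMap.annihilator_le_of_surjective g hg)))

/-- The fibre of M ⊗ N at p is the tensor product over κ(p) of two nonzero vector spaces. -/
lemma mem_support_tensorProduct {M N : Type u} [AddCommGroup M] [Module R M] [Module.Finite R M]
    [AddCommGroup N] [Module R N] [Module.Finite R N] {p : PrimeSpectrum R}
    (hM : p ∈ Module.support R M) (hN : p ∈ Module.support R N) :
    p ∈ Module.support R (M ⊗[R] N) := by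
  rw [Module.mem_support_iff_nontrivial_residueField_tensorProduct] at *
  let K := p.asIdeal.ResidueField
  have : Nontrivial ((K ⊗[R] M) ⊗[K] (K ⊗[R] N)) := inferInstance
  exact (TensorProduct.AlgebraTensorModule.distribBaseChange R K M N).toEquiv.nontrivial

/-- Ext is killed by the annihilators of both M and N, whose zero loci are the supports of M and N.
-/
lemma support_ext_subset [IsNoetherianRing R] (M N : Type u) [AddCommGroup M] [Module R M]
    [Module.Finite R M] [AddCommGroup N] [Module R N] [Module.Finite R N] (q : ℕ) :
    Module.support R (Ext (ModuleCat.of R M) (ModuleCat.of R N) q) ⊆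
      Module.support R (M ⊗[R] N) := by
  intro p hp
  have h := Module.annihilator_le_of_mem_support hp
  refine mem_support_tensorProduct ?_ ?_
  · rw [Module.support_eq_zeroLocus]
    refine fun r hr => h (Module.mem_annihilator.2 fun e => ?_)
    exact ext_smul_eq_zero_of_left (Module.mem_annihilator.1 hr) e
  · rw [Module.support_eq_zeroLocus]
    refine fun r hr => h (Module.mem_annihilator.2 fun e => ?_)
    exact ext_smul_eq_zero_of_right (Module.mem_annihilator.1 hr) e

end Support

/-! ### Consequences of the composite-functor spectral sequence by dimension shifting. -/

section Composition

variable [IsNoetherianRing R] (I : Ideal R) (M : Type u) [AddCommGroup M] [Module R M]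

section Step

variable {M} {X Y Z : Type u} [AddCommGroup X] [Module R X] [AddCommGroup Y] [Module R Y]
  [AddCommGroup Z] [Module R Z] [Module.Injective R Y] {f : X →ₗ[R] Y} {g : Y →ₗ[R] Z}

omit [IsNoetherianRing R] [Module.Injective R Y] in
-- With `IsSES.range_extOne`, this cuts 0 → Hom(M,X) → Hom(M,Y) → Hom(M,Z) → Ext^1(M,X) → 0 at the
-- image in Hom(M,Z).
lemma IsSES.extZero_range (hs : IsSES f g) :
    IsSES (extMap (ModuleCat.of R M) f 0) (extMap (ModuleCat.of R M) g 0).rangeRestrict :=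
  isSES_rangeRestrict (extMap_zero_injective hs.inj) (extMap_exact hs 0)

omit [IsNoetherianRing R] in
lemma IsSES.range_extOne (hs : IsSES f g) :
    IsSES (LinearMap.range (extMap (ModuleCat.of R M) g 0)).subtype
      (extδ (ModuleCat.of R M) hs 0) :=
  isSES_range_subtype (extMap_extδ_exact hs 0)
    (surjective_of_exact (extδ_extMap_exact hs 0) (subsingleton_ext_of_injective 0))

variable [Module.Finite R M]

lemma IsSES.subsingleton_lc_range (hs : IsSES f g) {p : ℕ}
    (h : Subsingleton (localCohomologyModule I
      (Ext (ModuleCat.of R M) (ModuleCat.of R X) 0) (p + 2))) :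
    Subsingleton (localCohomologyModule I
      (LinearMap.range (extMap (ModuleCat.of R M) g 0)) (p + 1)) :=
  hs.extZero_range.subsingleton_right (subsingleton_lc_extZero I Y p M) h

lemma IsSES.subsingleton_lc_extZero (hs : IsSES f g) {p : ℕ}
    (h : Subsingleton (localCohomologyModule I
      (Ext (ModuleCat.of R M) (ModuleCat.of R X) 0) (p + 2)))
    (h' : Subsingleton (localCohomologyModule I
      (Ext (ModuleCat.of R M) (ModuleCat.of R X) 1) (p + 1))) :
    Subsingleton (localCohomologyModule I
      (Ext (ModuleCat.of R M) (ModuleCat.of R Z) 0) (p + 1)) :=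
  hs.range_extOne.subsingleton_mid (hs.subsingleton_lc_range I h) h'

omit [IsNoetherianRing R] [Module.Injective R Y] [Module.Finite R M] in
lemma IsSES.range_lcMap_extMap (hs : IsSES f g)
    (h : Subsingleton (localCohomologyModule I
      (Ext (ModuleCat.of R M) (ModuleCat.of R X) 0) 1)) :
    LinearMap.range (lcMap I R (extMap (ModuleCat.of R M) g 0) 0) =
      LinearMap.range (lcMap I R (LinearMap.range (extMap (ModuleCat.of R M) g 0)).subtype 0) := by
  have hcomp (x) : lcMap I R (extMap (ModuleCat.of R M) g 0) 0 x =
      lcMap I R (LinearMap.range (extMap (ModuleCat.of R M) g 0)).subtype 0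
        (lcMap I R (extMap (ModuleCat.of R M) g 0).rangeRestrict 0 x) := by
    rw [lcMap_comp_apply]; rfl
  apply le_antisymm
  · rintro _ ⟨x, rfl⟩
    exact ⟨_, (hcomp x).symm⟩
  · rintro _ ⟨x, rfl⟩
    obtain ⟨y, rfl⟩ := surjective_of_exact (hs.extZero_range.lcMap_lcδ_exact 0) h x
    exact ⟨y, hcomp y⟩

omit [IsNoetherianRing R] [Module.Injective R Y] [Module.Finite R M] in
lemma IsSES.lcδ_eq_zero_iff (hs : IsSES f g) (z : genLocalCohomology I M Z 0) :
    lcδ I M hs 0 z = 0 ↔ lcZeroEquiv I M Z z ∈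
      LinearMap.range (lcMap I R (extMap (ModuleCat.of R M) g 0) 0) := by
  rw [hs.lcMap_lcδ_exact 0 z]
  constructor
  · rintro ⟨y, rfl⟩
    exact ⟨lcZeroEquiv I M Y y, (lcZeroEquiv_lcMap I M g y).symm⟩
  · rintro ⟨y, hy⟩
    refine ⟨(lcZeroEquiv I M Y).symm y, (lcZeroEquiv I M Z).injective ?_⟩
    rw [lcZeroEquiv_lcMap, LinearEquiv.apply_symm_apply, hy]

end Step

variable [Module.Finite R M]

/-- If E_2^{p,q} = 0 for all p + q = i, the abutment vanishes in degree i. Replacing N by Z = E/N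
lowers i and shifts the rows q ≥ 2 down by one; the rows q = 0, 1 combine into Hom(M,Z). Degrees 0
and 1 are separate because H^0_I(M,E) need not vanish. -/
theorem subsingleton_lc_of_ext_antidiagonal (i : ℕ) (N : Type u) [AddCommGroup N] [Module R N]
    (h : ∀ p q, p + q = i → Subsingleton (localCohomologyModule I
      (Ext (ModuleCat.of R M) (ModuleCat.of R N) q) p)) :
    Subsingleton (genLocalCohomology I M N i) := by
  obtain ⟨E, _, _, f, _, hf⟩ := exists_injective_embedding R N
  have hs := isSES_mkQ_range hf
  induction i using Nat.strong_induction_on generalizing N E with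
  | _ i ih =>
  match i, h, ih with
  | 0, h, _ =>
    have := h 0 0 rfl
    exact (lcZeroEquiv I M N).toEquiv.subsingleton
  | 1, h, _ =>
    have h10 := h 1 0 rfl
    have h01 := h 0 1 rfl
    rw [hs.subsingleton_one_iff]
    intro z
    refine (hs.lcMap_lcδ_exact 0 z).1 ((hs.lcδ_eq_zero_iff I z).2 ?_)
    rw [hs.range_lcMap_extMap I h10]
    exact surjective_of_exact (hs.range_extOne.lcMap_exact 0) h01 _
  | i + 2, h, ih =>
    obtain ⟨E', _, _, f', _, hf'⟩ := exists_injective_embedding R (E ⧸ LinearMap.range f)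
    have := ih (i + 1) (by omega) (E ⧸ LinearMap.range f) (fun p q hpq => by
      match q with
      | 0 =>
        obtain rfl : p = i + 1 := hpq
        exact hs.subsingleton_lc_extZero I (h _ _ rfl) (h _ _ rfl)
      | q + 1 =>
        have := h p (q + 2) (by omega)
        exact (lcCongr I R (hs.extShiftEquiv (ModuleCat.of R M) q) p).toEquiv.subsingleton)
      E' inferInstance inferInstance f' inferInstance hf' (isSES_mkQ_range hf')
    exact (hs.injectiveShiftEquiv i).symm.toEquiv.subsingleton

/-- The one-row case: Hom(M,-) keeps 0 → N → E → Z → 0 exact, Z inherits the vanishing of higher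
Ext, and Hom(M,E) is acyclic, so both sides shift in parallel. In degree one both are cokernels in
degree zero, matched by `lcZeroEquiv`. -/
theorem nonempty_lc_equiv_extZero (i : ℕ) (N : Type u) [AddCommGroup N] [Module R N]
    (h : ∀ q, Subsingleton (Ext (ModuleCat.of R M) (ModuleCat.of R N) (q + 1))) :
    Nonempty (genLocalCohomology I M N i ≃ₗ[R]
      localCohomologyModule I (Ext (ModuleCat.of R M) (ModuleCat.of R N) 0) i) := by
  have step (N : Type u) [AddCommGroup N] [Module R N] (h1 : Subsingleton
        (Ext (ModuleCat.of R M) (ModuleCat.of R N) 1)) {E Z : Type u} [AddCommGroup E] [Module R E]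
        [AddCommGroup Z] [Module R Z] {f : N →ₗ[R] E} {g : E →ₗ[R] Z} (hs : IsSES f g) :
        IsSES (extMap (ModuleCat.of R M) f 0) (extMap (ModuleCat.of R M) g 0) :=
    ⟨extMap_zero_injective hs.inj, extMap_exact hs 0,
      surjective_of_exact (extMap_extδ_exact hs 0) h1⟩
  induction i using Nat.strong_induction_on generalizing N with
  | _ i ih =>
  obtain ⟨E, _, _, f, _, hf⟩ := exists_injective_embedding R N
  have hs := isSES_mkQ_range hf
  have hs' := step N (h 0) hs
  match i, ih with
  | 0, _ => exact ⟨lcZeroEquiv I M N⟩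
  | 1, _ =>
    refine ⟨equivOfSurjective (g := lcδ I M hs 0) (g' := lcδ I R hs' 0) hs.lcδ_zero_surjective
      (surjective_of_exact (hs'.lcδ_lcMap_exact 0) (subsingleton_lc_extZero I E 0 M))
      (lcZeroEquiv I M _) fun z => ?_⟩
    rw [hs.lcδ_eq_zero_iff, hs'.lcMap_lcδ_exact 0]
    rfl
  | i + 2, ih =>
    obtain ⟨e⟩ := ih (i + 1) (by omega) (E ⧸ LinearMap.range f) fun q =>
      have := h (q + 1)
      (hs.extShiftEquiv (ModuleCat.of R M) q).toEquiv.subsingleton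
    exact ⟨(hs.injectiveShiftEquiv i).symm ≪≫ₗ e ≪≫ₗ
      hs'.shiftEquiv (subsingleton_lc_extZero I E i M) (subsingleton_lc_extZero I E (i + 1) M)⟩

variable {M} in
lemma IsSES.nonempty_lc_equiv_extOne {X Y Z : Type u} [AddCommGroup X] [Module R X]
    [AddCommGroup Y] [Module R Y] [AddCommGroup Z] [Module R Z] [Module.Injective R Y]
    {f : X →ₗ[R] Y} {g : Y →ₗ[R] Z} (hs : IsSES f g) (c : ℕ)
    (φ : genLocalCohomology I M Z c ≃ₗ[R]
      localCohomologyModule I (Ext (ModuleCat.of R M) (ModuleCat.of R Z) 0) c)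
    (hH : ∀ p, c < p → Subsingleton (localCohomologyModule I
      (Ext (ModuleCat.of R M) (ModuleCat.of R X) 0) p)) :
    Nonempty (genLocalCohomology I M X (c + 1) ≃ₗ[R]
      localCohomologyModule I (Ext (ModuleCat.of R M) (ModuleCat.of R X) 1) c) := by
  cases c with
  | zero =>
    have hsurj : Function.Surjective (lcMap I R (extδ (ModuleCat.of R M) hs 0) 0) :=
      surjective_of_exact (hs.range_extOne.lcMap_lcδ_exact 0)
        (hs.subsingleton_lc_range I (hH 2 (by omega)))
    refine ⟨equivOfSurjective hs.lcδ_zero_surjective hsurj (lcZeroEquiv I M Z) fun z => ?_⟩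
    rw [hs.lcδ_eq_zero_iff, hs.range_lcMap_extMap I (hH 1 (by omega))]
    exact (hs.range_extOne.lcMap_exact 0 _).symm
  | succ c =>
    exact ⟨(hs.injectiveShiftEquiv c).symm ≪≫ₗ φ ≪≫ₗ
      hs.range_extOne.quotEquiv (hs.subsingleton_lc_range I (hH (c + 2) (by omega)))
        (hs.subsingleton_lc_range I (hH (c + 3) (by omega)))⟩

/-- The corner isomorphism `H^{c+e}_I(M, N) ≅ H^c_I(Ext^e(M, N))`. -/
theorem nonempty_lc_equiv_ext (c e : ℕ) (N : Type u) [AddCommGroup N] [Module R N]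
    (hE : ∀ q, e < q → Subsingleton (Ext (ModuleCat.of R M) (ModuleCat.of R N) q))
    (hH : ∀ p q, c < p → Subsingleton (localCohomologyModule I
      (Ext (ModuleCat.of R M) (ModuleCat.of R N) q) p)) :
    Nonempty (genLocalCohomology I M N (c + e) ≃ₗ[R]
      localCohomologyModule I (Ext (ModuleCat.of R M) (ModuleCat.of R N) e) c) := by
  induction e generalizing N with
  | zero => exact nonempty_lc_equiv_extZero I M c N fun q => hE _ (by omega)
  | succ e ih =>
    obtain ⟨E, _, _, f, _, hf⟩ := exists_injective_embedding R N
    have hs := isSES_mkQ_range hf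
    have ih' := ih (E ⧸ LinearMap.range f)
      (fun q hq => by
        obtain ⟨q, rfl⟩ := Nat.exists_eq_succ_of_ne_zero (by omega : q ≠ 0)
        have := hE (q + 2) (by omega)
        exact (hs.extShiftEquiv (ModuleCat.of R M) q).toEquiv.subsingleton)
      (fun p q hp => by
        match q with
        | 0 =>
          obtain ⟨p, rfl⟩ := Nat.exists_eq_succ_of_ne_zero (by omega : p ≠ 0)
          exact hs.subsingleton_lc_extZero I (hH _ _ (by omega)) (hH _ _ (by omega))
        | q + 1 =>
          have := hH p (q + 2) hp
          exact (lcCongr I R (hs.extShiftEquiv (ModuleCat.of R M) q) p).toEquiv.subsingleton)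
    obtain ⟨φ⟩ := ih'
    -- Ext^{e+1}(M,Z) ≅ Ext^{e+2}(M,N), but Hom(M,Z) → Ext^1(M,N) is only surjective. Its kernel,
    -- the image of Hom(M,E), has no cohomology above degree c - 1, so it does not affect H^c when c
    -- ≥ 1; for c = 0 kernels are compared directly.
    match e with
    | 0 => exact hs.nonempty_lc_equiv_extOne I c φ fun p hp => hH p 0 hp
    | e + 1 =>
      exact ⟨(hs.injectiveShiftEquiv (c + e)).symm ≪≫ₗ φ ≪≫ₗ
        lcCongr I R (hs.extShiftEquiv (ModuleCat.of R M) e) c⟩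

end Composition

/-! ### Suprema of sets of naturals in `WithBot ℕ∞`. -/

section Suprema

variable {P : ℕ → Prop}

lemma iSup_natCast_le_iff {c : ℕ} :
    (⨆ (i : ℕ) (_ : P i), (i : WithBot ℕ∞)) ≤ c ↔ ∀ i, c < i → ¬ P i := by
  simp only [iSup_le_iff, Nat.cast_le]
  exact forall_congr' fun i => ⟨fun h hi hP => absurd (h hP) (by omega), fun h hP => by
    by_contra hc; exact h (by omega) hP⟩

lemma iSup_natCast_eq_bot_iff :
    (⨆ (i : ℕ) (_ : P i), (i : WithBot ℕ∞)) = ⊥ ↔ ∀ i, ¬ P i := by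
  simp only [iSup_eq_bot]
  exact forall_congr' fun i => ⟨fun h hP => WithBot.coe_ne_bot (h hP), fun h hP => absurd hP h⟩

/-- A finite supremum is attained: otherwise c - 1, or `⊥` when c = 0, would already be an upper
bound. -/
lemma iSup_natCast_eq_iff {c : ℕ} :
    (⨆ (i : ℕ) (_ : P i), (i : WithBot ℕ∞)) = c ↔ P c ∧ ∀ i, c < i → ¬ P i := by
  constructor
  · intro h
    have hle := iSup_natCast_le_iff.1 h.le
    refine ⟨?_, hle⟩
    by_contra hc
    cases c with
    | zero =>
      have : (⨆ (i : ℕ) (_ : P i), (i : WithBot ℕ∞)) = ⊥ := by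
        rw [iSup_natCast_eq_bot_iff]
        rintro (_ | i)
        · exact hc
        · exact hle _ (by omega)
      rw [h] at this
      exact WithBot.coe_ne_bot this
    | succ c =>
      have : (⨆ (i : ℕ) (_ : P i), (i : WithBot ℕ∞)) ≤ c := by
        rw [iSup_natCast_le_iff]
        intro i hi
        rcases (show c + 1 ≤ i from hi).eq_or_lt with rfl | hi'
        · exact hc
        · exact hle _ hi'
      rw [h, Nat.cast_le] at this
      omega
  · rintro ⟨hc, h⟩
    exact le_antisymm (iSup_natCast_le_iff.2 h)
      (le_iSup₂ (f := fun (i : ℕ) (_ : P i) => (i : WithBot ℕ∞)) c hc)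

lemma eq_bot_or_eq_natCast_or_eq_top (x : WithBot ℕ∞) : x = ⊥ ∨ (∃ n : ℕ, x = n) ∨ x = ⊤ := by
  induction x with
  | bot => exact Or.inl rfl
  | coe x =>
    induction x with
    | top => exact Or.inr (Or.inr rfl)
    | coe n => exact Or.inr (Or.inl ⟨n, rfl⟩)

end Suprema

/-! ### Cohomological dimension and the upper bound. -/

section Dimension

variable (I : Ideal R) (M N : Type u) [AddCommGroup M] [Module R M] [AddCommGroup N] [Module R N]

variable {I N} in
lemma cd_le_iff {c : ℕ} :
    cd I N ≤ c ↔ ∀ i, c < i → Subsingleton (localCohomologyModule I N i) := by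
  simp only [cd, iSup_natCast_le_iff, not_nontrivial_iff_subsingleton]

variable {I N} in
lemma cd_eq_bot_iff : cd I N = ⊥ ↔ ∀ i, Subsingleton (localCohomologyModule I N i) := by
  simp only [cd, iSup_natCast_eq_bot_iff, not_nontrivial_iff_subsingleton]

variable {I N} in
lemma cd_eq_iff {c : ℕ} : cd I N = c ↔ Nontrivial (localCohomologyModule I N c) ∧
    ∀ i, c < i → Subsingleton (localCohomologyModule I N i) := by
  simp only [cd, iSup_natCast_eq_iff, not_nontrivial_iff_subsingleton]

variable {I M N} in
lemma cdPair_le_iff {c : ℕ} :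
    cdPair I M N ≤ c ↔ ∀ i, c < i → Subsingleton (genLocalCohomology I M N i) := by
  simp only [cdPair, iSup_natCast_le_iff, not_nontrivial_iff_subsingleton]

variable {I M N} in
lemma cdPair_eq_bot_iff : cdPair I M N = ⊥ ↔ ∀ i, Subsingleton (genLocalCohomology I M N i) := by
  simp only [cdPair, iSup_natCast_eq_bot_iff, not_nontrivial_iff_subsingleton]

variable {I M N} in
lemma cdPair_eq_iff {c : ℕ} : cdPair I M N = c ↔ Nontrivial (genLocalCohomology I M N c) ∧
    ∀ i, c < i → Subsingleton (genLocalCohomology I M N i) := by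
  simp only [cdPair, iSup_natCast_eq_iff, not_nontrivial_iff_subsingleton]

variable {M N} in
lemma extSup_le_iff {e : ℕ} : extSup R M N ≤ e ↔
    ∀ i, e < i → Subsingleton (Ext (ModuleCat.of R M) (ModuleCat.of R N) i) := by
  simp only [extSup, iSup_natCast_le_iff, not_nontrivial_iff_subsingleton]

variable {M N} in
lemma extSup_eq_bot_iff : extSup R M N = ⊥ ↔
    ∀ i, Subsingleton (Ext (ModuleCat.of R M) (ModuleCat.of R N) i) := by
  simp only [extSup, iSup_natCast_eq_bot_iff, not_nontrivial_iff_subsingleton]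

variable [IsNoetherianRing R]

theorem cd_lt_top : cd I N < ⊤ := by
  obtain ⟨n, hn⟩ := exists_forall_subsingleton_lc I
  refine lt_of_le_of_lt (cd_le_iff.2 fun i hi => hn i hi N) ?_
  exact WithBot.coe_lt_coe.2 (ENat.natCast_lt_top n)

variable [Module.Finite R M] [Module.Finite R N]

lemma subsingleton_lc_ext {c : ℕ}
    (h : ∀ p, c ≤ p → Subsingleton (localCohomologyModule I (M ⊗[R] N) p)) (p q : ℕ)
    (hp : c ≤ p) : Subsingleton (localCohomologyModule I
      (Ext (ModuleCat.of R M) (ModuleCat.of R N) q) p) :=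
  subsingleton_lc_of_support_subset I (M ⊗[R] N) h _ (support_ext_subset M N q) hp

lemma cdPair_eq_bot_of_cd_eq_bot (h : cd I (M ⊗[R] N) = ⊥) : cdPair I M N = ⊥ :=
  cdPair_eq_bot_iff.2 fun i => subsingleton_lc_of_ext_antidiagonal I M i N fun p q _ =>
    subsingleton_lc_ext I M N (fun p _ => cd_eq_bot_iff.1 h p) p q (Nat.zero_le p)

lemma subsingleton_lc_of_add_lt {c e : ℕ} (hc : cd I (M ⊗[R] N) ≤ c) (he : extSup R M N ≤ e)
    {i : ℕ} (hi : c + e < i) : Subsingleton (genLocalCohomology I M N i) := by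
  refine subsingleton_lc_of_ext_antidiagonal I M i N fun p q hpq => ?_
  by_cases hp : c < p
  · exact subsingleton_lc_ext I M N (c := c + 1) (fun p hp => cd_le_iff.1 hc p hp) p q hp
  · have := extSup_le_iff.1 he q (by omega)
    exact subsingleton_lc_of_subsingleton I R _ p

lemma cdPair_le_cd_add_extSup :
    cdPair I M N ≤ cd I (M ⊗[R] N) + extSup R M N := by
  obtain hc | ⟨c, hc⟩ | hc := eq_bot_or_eq_natCast_or_eq_top (cd I (M ⊗[R] N))
  · rw [cdPair_eq_bot_of_cd_eq_bot I M N hc]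
    exact bot_le
  · obtain he | ⟨e, he⟩ | he := eq_bot_or_eq_natCast_or_eq_top (extSup R M N)
    · have : cdPair I M N = ⊥ := cdPair_eq_bot_iff.2 fun i =>
        subsingleton_lc_of_ext_antidiagonal I M i N fun p q _ =>
          have := extSup_eq_bot_iff.1 he q
          subsingleton_lc_of_subsingleton I R _ p
      rw [this]
      exact bot_le
    · rw [hc, he, ← Nat.cast_add, cdPair_le_iff]
      exact fun i hi => subsingleton_lc_of_add_lt I M N hc.le he.le hi
    · rw [hc, he]
      exact le_top
  · exact absurd hc (cd_lt_top I _).ne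

end Dimension

end GenLocalCohomology

end

theorem proposition2p2 {R : Type u} [CommRing R] [IsNoetherianRing R]
    (I : Ideal R) (hI : I ≠ ⊤)
    (M N : Type u) [AddCommGroup M] [Module R M] [Module.Finite R M]
    [AddCommGroup N] [Module R N] [Module.Finite R N] :
    GenLocalCohomology.cdPair I M N ≤
        GenLocalCohomology.cd I (M ⊗[R] N) + GenLocalCohomology.extSup R M N ∧
    GenLocalCohomology.cd I (M ⊗[R] N) < ⊤ ∧
    ∀ e : ℕ, GenLocalCohomology.extSup R M N = e →
      (∀ c : ℕ, GenLocalCohomology.cd I (M ⊗[R] N) = c →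
        Nonempty (GenLocalCohomology.genLocalCohomology I M N (c + e) ≃ₗ[R]
          GenLocalCohomology.localCohomologyModule I
            (Ext (ModuleCat.of R M) (ModuleCat.of R N) e) c)) ∧
      (GenLocalCohomology.cdPair I M N =
          GenLocalCohomology.cd I (M ⊗[R] N) + GenLocalCohomology.extSup R M N ↔
        GenLocalCohomology.cd I (Ext (ModuleCat.of R M) (ModuleCat.of R N) e) =
          GenLocalCohomology.cd I (M ⊗[R] N)) := by
  open GenLocalCohomology in
  refine ⟨cdPair_le_cd_add_extSup I M N, cd_lt_top I _, fun e he => ?_⟩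
  have hvan (c : ℕ) (hc : cd I (M ⊗[R] N) = c) (p q : ℕ) (hp : c < p) :
      Subsingleton (localCohomologyModule I
        (Ext (ModuleCat.of R M) (ModuleCat.of R N) q) p) :=
    subsingleton_lc_ext I M N (c := c + 1) (fun p hp => (cd_eq_iff.1 hc).2 p hp) p q hp
  have hiso (c : ℕ) (hc : cd I (M ⊗[R] N) = c) :
      Nonempty (genLocalCohomology I M N (c + e) ≃ₗ[R] localCohomologyModule I
        (Ext (ModuleCat.of R M) (ModuleCat.of R N) e) c) :=
    nonempty_lc_equiv_ext I M c e N (extSup_le_iff.1 he.le) (hvan c hc)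
  refine ⟨hiso, ?_⟩
  obtain hc | ⟨c, hc⟩ | hc := eq_bot_or_eq_natCast_or_eq_top (cd I (M ⊗[R] N))
  · rw [hc, WithBot.bot_add, cdPair_eq_bot_of_cd_eq_bot I M N hc, cd_eq_bot_iff]
    exact iff_of_true rfl fun p =>
      subsingleton_lc_ext I M N (fun p _ => cd_eq_bot_iff.1 hc p) p e (Nat.zero_le p)
  · obtain ⟨φ⟩ := hiso c hc
    rw [hc, he, ← Nat.cast_add, cdPair_eq_iff, cd_eq_iff, φ.toEquiv.nontrivial_congr]
    -- Vanishing above c + e and above c holds in any case, so each equality says only that the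
    -- corner module is nonzero, and φ identifies the two corners.
    exact and_congr_right fun _ => iff_of_true
      (fun i hi => subsingleton_lc_of_add_lt I M N hc.le he.le hi) (fun p hp => hvan c hc p e hp)
  · exact absurd hc (cd_lt_top I _).ne
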